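/- **Conventions.** All limits are taken as $x\wedge y\to\infty$ (respectively $x_1\wedge x_2\wedge x_3\to\infty$), and $f\sim g$ means $f/g\to1$. For a distribution $V$ on $\mathbb R$ put $\overline V(x)=V((x,\infty))$. We write $V\in\mathcal D\cap\mathcal L$ if $\overline V(x)>0$ for all $x$, $\limsup_{x\to\infty}\overline V(tx)/\overline V(x)<\infty$ for all $0<t<1$, and $\lim_{x\to\infty}\overline V(x-a)/\overline V(x)=1$ for all $a>0$. Random variables $X,Y$ with distributions $F,G$ are *strongly asymptotically independent* (SAI) with constant $C>0$ if, as $x\wedge y\to\infty$, $P(X^->x,Y>y)=O[F(-x)\overline G(y)]$, $P(X>x,Y^->y)=O[\overline F(x)G(-y)]$ and $P(X>x,Y>y)\sim C\,\overline F(x)\overline G(y)$. Families $(X_i)$, $(Y_j)$ are *generalized tail asymptotically independent* (GTAI) if $$\lim_{x_i\wedge x_k\wedge y_j\to\infty}P(|X_i|>x_i\mid X_k>x_k,Y_j>y_j)=0\ \ (i\ne k,\ \text{all } j),\qquad \lim_{y_j\wedge x_i\wedge y_k\to\infty}P(|Y_j|>y_j\mid X_i>x_i,Y_k>y_k)=0\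 \ (j\ne k,\ \text{all } i).$$ **Model.** Let $\theta_1,\theta_2,\dots$ be i.i.d. positive random variables, $T_i=\theta_1+\dots+\theta_i$, $N(t)=\#\{i\ge1:T_i\le t\}$, $\lambda(t)=E[N(t)]=\sum_{i\ge1}P(T_i\le t)$, and let $\lambda(dt)$ be the corresponding renewal measure. Let $C_1,C_2$ be premium processes with non-decreasing càdlàg paths and $C_1(0)=C_2(0)=0$, let $(X_i,Y_i)_{i\ge1}$ be real-valued claim pairs, and let $r\ge0$. For initial capitals $x,y$ define the discounted surpluses $$U_1(t)=x+\int_{0-}^te^{-rs}C_1(ds)-\sum_{i=1}^{N(t)}X_ie^{-rT_i},\qquad U_2(t)=y+\int_{0-}^te^{-rs}C_2(ds)-\sum_{i=1}^{N(t)}Y_ie^{-rT_i},$$ the ruin times (with $\inf\emptyset=\infty$) $$T_{\max}=\inf\{t>0:U_1(t)\vee U_2(t)<0\},\qquad T_{\mathrm{and}}=\inf\Big\{t>0:\inf_{0\le s\le t}U_1(s)<0,\ \inf_{0\le s\le t}U_2(s)<0\Big\},$$ and the ruin probabilities $\psi_{\max}(x,y;T)=P(T_{\max}\le T)$, $\psi_{\mathrm{and}}(x,y;T)=P(T_{\mathrm{and}}\le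 T)$. **Theorem.** Assume that the sequence $\{(X_i,Y_i)\}_{i\ge1}$, the process $\{(C_1(t),C_2(t))\}_{t\ge0}$ and the process $\{N(t)\}_{t\ge0}$ are mutually independent; that the pairs $(X_i,Y_i)$ are identically distributed with marginals $F,G\in\mathcal D\cap\mathcal L$; that $(X_i)$, $(Y_j)$ are GTAI; that $X_i,Y_i$ are SAI with constant $C>0$ for every $i$; and that $X_i$ and $Y_j$ are independent whenever $i\ne j$. Then for every finite $T>0$ with $\lambda(T)>0$, as $x\wedge y\to\infty$, $$\psi_{\max}(x,y;T)\sim\psi_{\mathrm{and}}(x,y;T)\sim\Delta(x,y;T),$$ where $$\Delta(x,y;T)=\iint_{s,t\ge0,\ s+t\le T}\left[\overline F(xe^{r(t+s)})\,\overline G(ye^{rt})+\overline F(xe^{rt})\,\overline G(ye^{r(t+s)})\right]\lambda(ds)\,\lambda(dt)+C\int_0^T\overline F(xe^{rt})\,\overline G(ye^{rt})\,\lambda(dt).$$ -/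

import Mathlib

open MeasureTheory ProbabilityTheory Filter Set
open scoped Topology NNReal ENNReal Asymptotics

noncomputable section

namespace RenewalRisk

/-! ### Limits and distribution classes -/

/-- The mode of convergence `x ∧ y → ∞`. -/
def minAtTop₂ : Filter (ℝ × ℝ) :=
  comap (fun p => min p.1 p.2) atTop

/-- The mode of convergence `x ∧ y ∧ z → ∞`. -/
def minAtTop₃ : Filter (ℝ × ℝ × ℝ) :=
  comap (fun p => min p.1 (min p.2.1 p.2.2)) atTop

/-- The tail `V̄(x) = V((x, ∞))` of a distribution `V` on the real line. -/
def tail (V : Measure ℝ) (x : ℝ) : ℝ := V.real (Ioi x)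

/-- Infinite right endpoint. -/
def InfiniteEndpoint (V : Measure ℝ) : Prop := ∀ x : ℝ, 0 < tail V x

/-- Long-tailed distributions (the class `𝓛`). -/
def LongTailed (V : Measure ℝ) : Prop :=
  ∀ a : ℝ, 0 < a → Tendsto (fun x => tail V (x - a) / tail V x) atTop (𝓝 1)

/-- Dominatedly varying tails (the class `𝓓`): for every `0 < t < 1`, the upper limit of
`V̄(t x) / V̄(x)` at infinity is finite. -/
def DominatedlyVarying (V : Measure ℝ) : Prop :=
  ∀ t : ℝ, 0 < t → t < 1 →
    IsBoundedUnder (· ≤ ·) atTop (fun x => tail V (t * x) / tail V x)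

/-- The class `𝓓 ∩ 𝓛`, within the distributions with infinite right endpoint. -/
def ClassDL (V : Measure ℝ) : Prop :=
  InfiniteEndpoint V ∧ DominatedlyVarying V ∧ LongTailed V

/-! ### Dependence structures -/

section Dependence

variable {Ω : Type*} [MeasurableSpace Ω]

/-- `X` and `Y` are strongly asymptotically independent with constant `C`.
Here `max (-z) 0` is the negative part of `z`. -/
def SAI (μ : Measure Ω) (X Y : Ω → ℝ) (C : ℝ) : Prop :=
  0 < C ∧
  (fun p : ℝ × ℝ => μ.real {ω | p.1 < max (-X ω) 0 ∧ p.2 < Y ω}) =O[minAtTop₂]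
    (fun p : ℝ × ℝ => μ.real {ω | X ω ≤ -p.1} * μ.real {ω | p.2 < Y ω}) ∧
  (fun p : ℝ × ℝ => μ.real {ω | p.1 < X ω ∧ p.2 < max (-Y ω) 0}) =O[minAtTop₂]
    (fun p : ℝ × ℝ => μ.real {ω | p.1 < X ω} * μ.real {ω | Y ω ≤ -p.2}) ∧
  Tendsto (fun p : ℝ × ℝ => μ.real {ω | p.1 < X ω ∧ p.2 < Y ω} /
    (μ.real {ω | p.1 < X ω} * μ.real {ω | p.2 < Y ω})) minAtTop₂ (𝓝 C)

/-- The families `X` and `Y` are generalized tail asymptotically independent. -/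
def GTAI {ι κ : Type*} (μ : Measure Ω) (X : ι → Ω → ℝ) (Y : κ → Ω → ℝ) : Prop :=
  (∀ (i k : ι) (j : κ), i ≠ k →
    Tendsto (fun p : ℝ × ℝ × ℝ =>
      μ[{ω | p.1 < |X i ω|} | {ω | p.2.1 < X k ω ∧ p.2.2 < Y j ω}]) minAtTop₃ (𝓝 0)) ∧
  (∀ (j k : κ) (i : ι), j ≠ k →
    Tendsto (fun p : ℝ × ℝ × ℝ =>
      μ[{ω | p.1 < |Y j ω|} | {ω | p.2.1 < X i ω ∧ p.2.2 < Y k ω}]) minAtTop₃ (𝓝 0))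

end Dependence

/-! ### The renewal process -/

section Renewal

variable {Ω : Type*}

/-- The arrival times: `arrival θ i = θ 0 + ⋯ + θ i` is the time of the claim with (zero-based)
number `i`, where `θ` is the sequence of inter-arrival times. -/
def arrival (θ : ℕ → Ω → ℝ) (i : ℕ) (ω : Ω) : ℝ := ∑ k ∈ Finset.range (i + 1), θ k ω

/-- The counting process `N(t)`: the number of arrivals up to time `t`. For independent identically
distributed positive inter-arrival times this number is almost surely finite for all `t`. -/
def counting (θ : ℕ → Ω → ℝ) (t : ℝ) (ω : Ω) : ℕ := {i : ℕ | arrival θ i ω ≤ t}.ncard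

variable [MeasurableSpace Ω]

/-- The renewal function `λ(t) = ∑ᵢ P(Tᵢ ≤ t)`, the mean of `N(t)`. -/
def renewalMean (μ : Measure Ω) (θ : ℕ → Ω → ℝ) (t : ℝ) : ℝ≥0∞ :=
  ∑' i, μ {ω | arrival θ i ω ≤ t}

/-- The renewal measure `λ(dt) = ∑ᵢ P(Tᵢ ∈ dt)`. -/
def renewalMeasure (μ : Measure Ω) (θ : ℕ → Ω → ℝ) : Measure ℝ :=
  Measure.sum fun i => μ.map (arrival θ i)

/-- `renewalMean` is the distribution function of `renewalMeasure`. -/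
theorem renewalMeasure_Iic (μ : Measure Ω) (θ : ℕ → Ω → ℝ) (hθ : ∀ i, Measurable (θ i)) (t : ℝ) :
    renewalMeasure μ θ (Iic t) = renewalMean μ θ t := by
  have h : ∀ i, Measurable (arrival θ i) := fun i =>
    Finset.measurable_fun_sum _ fun k _ => hθ k
  rw [renewalMeasure, Measure.sum_apply _ measurableSet_Iic, renewalMean]
  exact tsum_congr fun i => Measure.map_apply (h i) measurableSet_Iic

end Renewal

/-! ### The surplus processes and the ruin probabilities -/

section Surplus

variable {Ω : Type*}

/-- Discounted aggregate claims `∑_{i = 1}^{N(t)} Xᵢ e^{-r Tᵢ}`. -/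
def discountedClaims (r : ℝ) (X θ : ℕ → Ω → ℝ) (t : ℝ) (ω : Ω) : ℝ :=
  ∑ i ∈ Finset.range (counting θ t ω), X i ω * Real.exp (-(r * arrival θ i ω))

/-- Discounted premiums `∫_{0-}^t e^{-r s} C(ds)`, a pathwise Lebesgue-Stieltjes integral. -/
def discountedPremiums (r : ℝ) (C : Ω → StieltjesFunction ℝ) (t : ℝ) (ω : Ω) : ℝ :=
  ∫ s in Icc 0 t, Real.exp (-(r * s)) ∂(C ω).measure

/-- The discounted surplus at time `t` of a line of business with initial capital `x`,
premium process `C`, claims `X` and inter-arrival times `θ`. -/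
def surplus (r : ℝ) (C : Ω → StieltjesFunction ℝ) (X θ : ℕ → Ω → ℝ) (x t : ℝ) (ω : Ω) : ℝ :=
  x + discountedPremiums r C t ω - discountedClaims r X θ t ω

/-- The first time at which both surplus processes are negative simultaneously (`⊤` if never). -/
def ruinTimeMax (U₁ U₂ : ℝ → Ω → ℝ) (ω : Ω) : EReal :=
  ⨅ (t : ℝ) (_ : 0 < t ∧ max (U₁ t ω) (U₂ t ω) < 0), (t : EReal)

/-- The first time by which both surplus processes have been negative, not necessarily
simultaneously (`⊤` if never). -/
def ruinTimeAnd (U₁ U₂ : ℝ → Ω → ℝ) (ω : Ω) : EReal :=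
  ⨅ (t : ℝ) (_ : 0 < t ∧ (⨅ s ∈ Icc 0 t, (U₁ s ω : EReal)) < 0 ∧
    (⨅ s ∈ Icc 0 t, (U₂ s ω : EReal)) < 0), (t : EReal)

variable [MeasurableSpace Ω]

/-- The ruin probability `ψ_max(x, y; T)`. -/
def ruinProbMax (μ : Measure Ω) (r : ℝ) (C₁ C₂ : Ω → StieltjesFunction ℝ) (X Y θ : ℕ → Ω → ℝ)
    (T x y : ℝ) : ℝ :=
  μ.real {ω | ruinTimeMax (surplus r C₁ X θ x) (surplus r C₂ Y θ y) ω ≤ (T : EReal)}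

/-- The ruin probability `ψ_and(x, y; T)`. -/
def ruinProbAnd (μ : Measure Ω) (r : ℝ) (C₁ C₂ : Ω → StieltjesFunction ℝ) (X Y θ : ℕ → Ω → ℝ)
    (T x y : ℝ) : ℝ :=
  μ.real {ω | ruinTimeAnd (surplus r C₁ X θ x) (surplus r C₂ Y θ y) ω ≤ (T : EReal)}

end Surplus

/-- The asymptotic expression `Δ(x, y; T)`, where `lam` is the renewal measure; the variable `p`
of the double integral is the pair `(s, t)`. -/
def deltaApprox (F G lam : Measure ℝ) (r C T x y : ℝ) : ℝ :=
  (∫ p in {p : ℝ × ℝ | 0 ≤ p.1 ∧ 0 ≤ p.2 ∧ p.1 + p.2 ≤ T},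
    (tail F (x * Real.exp (r * (p.2 + p.1))) * tail G (y * Real.exp (r * p.2)) +
      tail F (x * Real.exp (r * p.2)) * tail G (y * Real.exp (r * (p.2 + p.1))))
    ∂(lam.prod lam)) +
  C * ∫ t in Icc 0 T, tail F (x * Real.exp (r * t)) * tail G (y * Real.exp (r * t)) ∂lam

/-- Mutual independence of the sequence of claim pairs, the pair of premium processes and the
counting process. -/
def MutuallyIndependent {Ω : Type*} [MeasurableSpace Ω] (μ : Measure Ω) (X Y : ℕ → Ω → ℝ)
    (C₁ C₂ : Ω → StieltjesFunction ℝ) (θ : ℕ → Ω → ℝ) : Prop :=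
  iIndep ![
    MeasurableSpace.comap (fun ω (i : ℕ) => (X i ω, Y i ω)) inferInstance,
    MeasurableSpace.comap (fun ω (t : ℝ≥0) => (C₁ ω t, C₂ ω t)) inferInstance,
    MeasurableSpace.comap (fun ω (t : ℝ≥0) => counting θ t ω) inferInstance] μ

end RenewalRisk

end

noncomputable section

namespace RenewalRisk

/-! Ruin is reduced to weighted sums of claims. Premiums are nonnegative, so if both lines have been
ruined by time `T`, the discounted sums of the positive parts of the claims up to `T` exceed `x` and
`y` (`lt_sum_of_ruinTimeAnd_le`). Conversely both surpluses are negative at `T` itself once the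
discounted claims exceed `x + C₁(T)` and `y + C₂(T)` (`ruinTimeMax_le_of_lt`). The premiums are
independent of claims and arrivals and lie below a constant `M` with probability near one, and long
tails absorb the shift by `M`. Since `ψ_max ≤ ψ_and`, an upper bound for `ψ_and` and a lower bound
for `ψ_max` suffice.

Given the arrival times, the weights `e^{-r T_i}` are constants in `[e^{-rT}, 1]`. For a fixed
number of claims one big jump in each line decides: GTAI makes a second large claim in a line
negligible, long tails absorb the bounded remainder, and SAI (equal indices) or independence
(different indices) turns the joint tail of `X_i, Y_j` into a constant times the product of the
tails. This gives `pairSum`, uniformly in the weights (`exists_real_sum_le_pairSum`,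
`exists_pairSum_le_real_sum`).

The number of claims is unbounded, but dominated variation bounds the joint tail of `n` summands by
a power of `n` times `F̄(x)Ḡ(y)` (`exists_real_sum_le`). As `N(T)` has all moments and `F̄(x)Ḡ(y)`
is at most a multiple of `Δ`, large values of `N(T)` are negligible. Finally the mean of the random
`pairSum` is `Δ` (`integral_conditionalDelta`): the diagonal gives the term with `C`, and off the
diagonal the gap between two arrivals is independent of the earlier one. -/

theorem eventually_minAtTop₂ {P : ℝ × ℝ → Prop} :
    (∀ᶠ p in minAtTop₂, P p) ↔ ∃ R, ∀ x y, R ≤ x → R ≤ y → P (x, y) := by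
  unfold minAtTop₂
  rw [(atTop_basis.comap _).eventually_iff]
  constructor
  · rintro ⟨R, -, h⟩
    exact ⟨R, fun x y hx hy => h (x := (x, y)) (by simp [hx, hy])⟩
  · rintro ⟨R, h⟩
    refine ⟨R, trivial, fun p hp => ?_⟩
    simp only [mem_preimage, mem_Ici, le_min_iff] at hp
    exact h p.1 p.2 hp.1 hp.2

theorem eventually_minAtTop₃ {P : ℝ × ℝ × ℝ → Prop} :
    (∀ᶠ p in minAtTop₃, P p) ↔ ∃ R, ∀ x y z, R ≤ x → R ≤ y → R ≤ z → P (x, y, z) := by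
  unfold minAtTop₃
  rw [(atTop_basis.comap _).eventually_iff]
  constructor
  · rintro ⟨R, -, h⟩
    exact ⟨R, fun x y z hx hy hz => h (x := (x, y, z)) (by simp [hx, hy, hz])⟩
  · rintro ⟨R, h⟩
    refine ⟨R, trivial, fun p hp => ?_⟩
    simp only [mem_preimage, mem_Ici, le_min_iff] at hp
    exact h p.1 p.2.1 p.2.2 hp.1 hp.2.1 hp.2.2

/-! ### Long-tailed and dominatedly varying tails. -/

section Tail

variable {V : Measure ℝ}

theorem tail_nonneg (V : Measure ℝ) (x : ℝ) : 0 ≤ tail V x := measureReal_nonneg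

theorem tail_antitone (V : Measure ℝ) [IsFiniteMeasure V] : Antitone (tail V) := fun _ _ h =>
  measureReal_mono (Ioi_subset_Ioi h)

theorem measurable_tail (V : Measure ℝ) [IsFiniteMeasure V] : Measurable (tail V) :=
  (tail_antitone V).measurable

theorem LongTailed.exists_tail_sub_le (hL : LongTailed V) (hI : InfiniteEndpoint V) {ε L : ℝ}
    (hε : 0 < ε) (h0 : 0 < L) : ∃ R, ∀ x, R ≤ x → tail V (x - L) ≤ (1 + ε) * tail V x := by
  have h := (hL L h0).eventually (eventually_le_nhds (show (1 : ℝ) < 1 + ε by linarith))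
  obtain ⟨R, hR⟩ := eventually_atTop.1 h
  exact ⟨R, fun x hx => (div_le_iff₀ (hI x)).1 (hR x hx)⟩

theorem LongTailed.exists_le_tail_add (hL : LongTailed V) (hI : InfiniteEndpoint V) {ε L : ℝ}
    (hε : 0 < ε) (h0 : 0 < L) : ∃ R, ∀ x, R ≤ x → (1 - ε) * tail V x ≤ tail V (x + L) := by
  obtain ⟨R, hR⟩ := hL.exists_tail_sub_le hI hε h0
  refine ⟨R - L, fun x hx => ?_⟩
  have h := hR (x + L) (by linarith)
  rw [add_sub_cancel_right] at h
  have h1 := tail_nonneg V x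
  have h2 := tail_nonneg V (x + L)
  by_cases h3 : 1 - ε ≤ 0
  · nlinarith
  · push Not at h3
    -- Multiplying by `1 - ε` suffices because `(1 - ε)(1 + ε) ≤ 1`.
    nlinarith [mul_le_mul_of_nonneg_left h h3.le, mul_nonneg (sq_nonneg ε) h2]

theorem DominatedlyVarying.exists_tail_mul_le [IsFiniteMeasure V] (hD : DominatedlyVarying V)
    (hI : InfiniteEndpoint V) {a : ℝ} (h0 : 0 < a) (h1 : a ≤ 1) :
    ∃ K, 1 ≤ K ∧ ∃ R, ∀ x, R ≤ x → tail V (a * x) ≤ K * tail V x := by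
  rcases h1.eq_or_lt with rfl | h1
  · exact ⟨1, le_rfl, 0, fun x _ => by simp⟩
  obtain ⟨K, hK⟩ := hD a h0 h1
  rw [eventually_map, eventually_atTop] at hK
  obtain ⟨R, hR⟩ := hK
  refine ⟨max K 1, le_max_right _ _, R, fun x hx => ?_⟩
  have h : tail V (a * x) / tail V x ≤ K := hR x hx
  rw [div_le_iff₀ (hI _)] at h
  exact h.trans (mul_le_mul_of_nonneg_right (le_max_left _ _) (tail_nonneg _ _))

/-- Iterated halving. Halving is controlled only beyond `x₀`, so the argument is frozen at `x₀` once
it gets there; below `x₀` monotonicity is enough. -/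
theorem tail_dyadic_le [IsFiniteMeasure V] {B x₀ : ℝ} (hB : 1 ≤ B)
    (h : ∀ x, x₀ ≤ x → tail V (x / 2) ≤ B * tail V x) (k : ℕ) (x : ℝ) :
    tail V (max (x / 2 ^ k) x₀) ≤ B ^ k * tail V x := by
  induction k generalizing x with
  | zero => simpa using tail_antitone V (le_max_left x x₀)
  | succ k ih =>
    rcases le_total x₀ x with hx | hx
    · have h1 := ih (x / 2)
      rw [div_div, ← pow_succ'] at h1
      calc _ ≤ B ^ k * tail V (x / 2) := h1
        _ ≤ B ^ k * (B * tail V x) := mul_le_mul_of_nonneg_left (h x hx) (by positivity)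
        _ = B ^ (k + 1) * tail V x := by ring
    · calc tail V (max (x / 2 ^ (k + 1)) x₀) ≤ tail V x :=
            tail_antitone V (hx.trans (le_max_right _ _))
        _ ≤ B ^ (k + 1) * tail V x :=
            le_mul_of_one_le_left (tail_nonneg _ _) (one_le_pow₀ hB)

/-- Polynomial control of the tail at `x / n`, with the argument cut off at a fixed level. -/
theorem ClassDL.exists_tail_div_le [IsFiniteMeasure V] (hV : ClassDL V) :
    ∃ x₀ : ℝ, ∀ x₁, x₀ ≤ x₁ → ∃ p : ℕ, ∀ (n : ℕ) (x : ℝ), 1 ≤ n → 0 ≤ x →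
      tail V (max (x / n) x₁) ≤ (2 * n : ℝ) ^ p * tail V x := by
  obtain ⟨B, hB, R, hR⟩ := hV.2.1.exists_tail_mul_le hV.1 (a := 1 / 2) (by norm_num) (by norm_num)
  refine ⟨R, fun x₁ hx₁ => ?_⟩
  -- With `B ≤ 2 ^ p`, the factor for `k` halvings is at most `(2 ^ k) ^ p`; choosing `2 ^ k`
  -- between `n` and `2 * n` makes it polynomial in `n`.
  obtain ⟨p, hp⟩ := pow_unbounded_of_one_lt B (one_lt_two : (1 : ℝ) < 2)
  refine ⟨p, fun n x hn hx => ?_⟩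
  have half : ∀ x, x₁ ≤ x → tail V (x / 2) ≤ 2 ^ p * tail V x := fun x h => by
    have h1 := hR x (hx₁.trans h)
    rw [one_div_mul_eq_div] at h1
    exact h1.trans (mul_le_mul_of_nonneg_right hp.le (tail_nonneg _ _))
  have hn1 : (n : ℝ) ≤ 2 ^ (Nat.log 2 n + 1) := by
    exact_mod_cast (Nat.lt_pow_succ_log_self one_lt_two n).le
  have hn2 : (2 : ℝ) ^ (Nat.log 2 n + 1) ≤ 2 * n := by
    rw [pow_succ']
    gcongr
    exact_mod_cast Nat.pow_log_le_self 2 (by lia)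
  have hn0 : (0 : ℝ) < n := by exact_mod_cast hn
  calc tail V (max (x / n) x₁) ≤ tail V (max (x / 2 ^ (Nat.log 2 n + 1)) x₁) :=
        tail_antitone V (max_le_max_right _ (by gcongr))
    _ ≤ (2 ^ p) ^ (Nat.log 2 n + 1) * tail V x :=
        tail_dyadic_le (one_le_pow₀ one_le_two) half _ _
    _ = (2 ^ (Nat.log 2 n + 1)) ^ p * tail V x := by rw [← pow_mul, ← pow_mul, mul_comm p]
    _ ≤ (2 * n : ℝ) ^ p * tail V x := by
        gcongr
        exact tail_nonneg _ _

end Tail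

/-! ### Joint tails of two claims and a polynomial bound for sums. -/

section Claims

variable {Ω : Type*} [MeasurableSpace Ω]

/-- The assumptions on the claims. -/
structure ClaimPairs (μ : Measure Ω) (X Y : ℕ → Ω → ℝ) (F G : Measure ℝ) (C : ℝ) : Prop where
  measurable_fst : ∀ i, Measurable (X i)
  measurable_snd : ∀ i, Measurable (Y i)
  identDistrib : ∀ i, IdentDistrib (fun ω => (X i ω, Y i ω)) (fun ω => (X 0 ω, Y 0 ω)) μ μ
  map_fst : ∀ i, μ.map (X i) = F
  map_snd : ∀ i, μ.map (Y i) = G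
  classDL_fst : ClassDL F
  classDL_snd : ClassDL G
  gtai : GTAI μ X Y
  sai : ∀ i, SAI μ (X i) (Y i) C
  indepFun : ∀ i j, i ≠ j → IndepFun (X i) (Y j) μ

/-- The joint tail of two random variables. -/
def jointTail (μ : Measure Ω) (X Y : Ω → ℝ) (u v : ℝ) : ℝ :=
  μ.real {ω | u < X ω ∧ v < Y ω}

/-- The limit of the ratio of the joint tail of `X i` and `Y j` to the product of the tails. -/
def pairConst (C : ℝ) (i j : ℕ) : ℝ := if i = j then C else 1

theorem jointTail_nonneg (μ : Measure Ω) (X Y : Ω → ℝ) (u v : ℝ) : 0 ≤ jointTail μ X Y u v :=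
  measureReal_nonneg

theorem pairConst_pos {C : ℝ} (hC : 0 < C) (i j : ℕ) : 0 < pairConst C i j := by
  unfold pairConst; split_ifs <;> positivity

theorem pairConst_le {C : ℝ} (hC : 0 < C) (i j : ℕ) : pairConst C i j ≤ C + 1 := by
  unfold pairConst; split_ifs <;> linarith

theorem real_setOf_lt_eq_tail {μ : Measure Ω} {X : Ω → ℝ} {F : Measure ℝ} (hX : Measurable X)
    (h : μ.map X = F) (u : ℝ) : μ.real {ω | u < X ω} = tail F u := by
  rw [tail, ← h, map_measureReal_apply hX measurableSet_Ioi]; rfl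

namespace ClaimPairs

variable {μ : Measure Ω} [IsProbabilityMeasure μ] {X Y : ℕ → Ω → ℝ} {F G : Measure ℝ} {C : ℝ}
  (h : ClaimPairs μ X Y F G C)
include h

omit [IsProbabilityMeasure μ] in
theorem const_pos : 0 < C := (h.sai 0).1

theorem isProbabilityMeasure_fst : IsProbabilityMeasure F :=
  h.map_fst 0 ▸ Measure.isProbabilityMeasure_map (h.measurable_fst 0).aemeasurable

theorem isProbabilityMeasure_snd : IsProbabilityMeasure G :=
  h.map_snd 0 ▸ Measure.isProbabilityMeasure_map (h.measurable_snd 0).aemeasurable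

omit [IsProbabilityMeasure μ] in
theorem jointTail_of_ne {i j : ℕ} (hij : i ≠ j) (u v : ℝ) :
    jointTail μ (X i) (Y j) u v = tail F u * tail G v := by
  rw [← real_setOf_lt_eq_tail (h.measurable_fst i) (h.map_fst i),
    ← real_setOf_lt_eq_tail (h.measurable_snd j) (h.map_snd j)]
  have := (h.indepFun i j hij).measure_inter_preimage_eq_mul (Ioi u) (Ioi v) measurableSet_Ioi
    measurableSet_Ioi
  simp only [jointTail, measureReal_def, ← ENNReal.toReal_mul]
  exact congrArg _ this

omit [IsProbabilityMeasure μ] in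
theorem jointTail_self (i : ℕ) (u v : ℝ) :
    jointTail μ (X i) (Y i) u v = jointTail μ (X 0) (Y 0) u v :=
  congrArg ENNReal.toReal ((h.identDistrib i).measure_mem_eq
    (measurableSet_Ioi.prod measurableSet_Ioi : MeasurableSet (Ioi u ×ˢ Ioi v)))

omit [IsProbabilityMeasure μ] in
-- One threshold serves all indices: the diagonal reduces to index 0 because the pairs are
-- identically distributed, and off the diagonal independence gives an exact product.
theorem exists_jointTail_near {ε : ℝ} (hε : 0 < ε) : ∃ R, ∀ u v, R ≤ u → R ≤ v → ∀ i j,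
    (1 - ε) * (pairConst C i j * (tail F u * tail G v)) ≤ jointTail μ (X i) (Y j) u v ∧
    jointTail μ (X i) (Y j) u v ≤ (1 + ε) * (pairConst C i j * (tail F u * tail G v)) := by
  have hC := h.const_pos
  have h1 := (h.sai 0).2.2.2.eventually
    (Icc_mem_nhds (show (1 - ε) * C < C by nlinarith) (show C < (1 + ε) * C by nlinarith))
  obtain ⟨R, hR⟩ := eventually_minAtTop₂.1 h1
  refine ⟨R, fun u v hu hv i j => ?_⟩
  have hpos : 0 < tail F u * tail G v := mul_pos (h.classDL_fst.1 u) (h.classDL_snd.1 v)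
  by_cases hij : i = j
  · subst hij
    have h2 := hR u v hu hv
    simp only [real_setOf_lt_eq_tail (h.measurable_fst 0) (h.map_fst 0),
      real_setOf_lt_eq_tail (h.measurable_snd 0) (h.map_snd 0), le_div_iff₀ hpos,
      div_le_iff₀ hpos] at h2
    rw [h.jointTail_self, pairConst, if_pos rfl, ← mul_assoc, ← mul_assoc (1 + ε)]
    exact h2
  · rw [h.jointTail_of_ne hij, pairConst, if_neg hij]
    constructor <;> nlinarith

omit [IsProbabilityMeasure μ] in
theorem exists_jointTail_sub_le {ε L : ℝ} (hε : 0 < ε) (hL : 0 < L) :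
    ∃ R, ∀ u v, R ≤ u → R ≤ v → ∀ i j, jointTail μ (X i) (Y j) (u - L) (v - L) ≤
      (1 + ε) * (pairConst C i j * (tail F u * tail G v)) := by
  -- For `d ≤ 1` one has `(1 + d)³ ≤ 1 + 7d`; the three factors come from the joint tail and the two
  -- shifts.
  have hd : 0 < min 1 (ε / 7) := by positivity
  set d := min 1 (ε / 7) with hd'
  have hd1 : d ≤ 1 := min_le_left _ _
  have hd2 : d ≤ ε / 7 := min_le_right _ _
  obtain ⟨R₁, h₁⟩ := h.exists_jointTail_near hd
  obtain ⟨R₂, h₂⟩ := h.classDL_fst.2.2.exists_tail_sub_le h.classDL_fst.1 hd hL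
  obtain ⟨R₃, h₃⟩ := h.classDL_snd.2.2.exists_tail_sub_le h.classDL_snd.1 hd hL
  refine ⟨max (R₁ + L) (max R₂ R₃), fun u v hu hv i j => ?_⟩
  simp only [max_le_iff] at hu hv
  have hc := pairConst_pos h.const_pos i j
  have hF := tail_nonneg F u
  have hG := tail_nonneg G v
  calc _ ≤ (1 + d) * (pairConst C i j * (tail F (u - L) * tail G (v - L))) :=
        (h₁ _ _ (by linarith) (by linarith) i j).2
    _ ≤ (1 + d) * (pairConst C i j * (((1 + d) * tail F u) * ((1 + d) * tail G v))) := by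
        gcongr
        · exact tail_nonneg _ _
        · exact h₂ u hu.2.1
        · exact h₃ v hv.2.2
    _ = ((1 + d) * (1 + d) * (1 + d)) * (pairConst C i j * (tail F u * tail G v)) := by ring
    _ ≤ _ := by
        gcongr
        nlinarith [mul_nonneg hd.le (sub_nonneg.2 hd1),
          mul_nonneg (mul_nonneg hd.le hd.le) (sub_nonneg.2 hd1)]

omit [IsProbabilityMeasure μ] in
theorem exists_le_jointTail_add {ε L : ℝ} (hε : 0 < ε) (hL : 0 < L) :
    ∃ R, ∀ u v, R ≤ u → R ≤ v → ∀ i j,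
      (1 - ε) * (pairConst C i j * (tail F u * tail G v)) ≤
        jointTail μ (X i) (Y j) (u + L) (v + L) := by
  -- Here `(1 - d)³ ≥ 1 - 3d` for `0 ≤ d ≤ 1`.
  have hd : 0 < min 1 (ε / 3) := by positivity
  set d := min 1 (ε / 3) with hd'
  have hd1 : d ≤ 1 := min_le_left _ _
  have hd2 : d ≤ ε / 3 := min_le_right _ _
  obtain ⟨R₁, h₁⟩ := h.exists_jointTail_near hd
  obtain ⟨R₂, h₂⟩ := h.classDL_fst.2.2.exists_le_tail_add h.classDL_fst.1 hd hL
  obtain ⟨R₃, h₃⟩ := h.classDL_snd.2.2.exists_le_tail_add h.classDL_snd.1 hd hL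
  refine ⟨max R₁ (max R₂ R₃), fun u v hu hv i j => ?_⟩
  simp only [max_le_iff] at hu hv
  have hc := pairConst_pos h.const_pos i j
  have hF := tail_nonneg F u
  have hG := tail_nonneg G v
  have hd3 : 0 ≤ 1 - d := by linarith
  calc _ ≤ ((1 - d) * (1 - d) * (1 - d)) * (pairConst C i j * (tail F u * tail G v)) := by
        gcongr
        nlinarith [mul_nonneg hd.le hd.le, mul_nonneg (mul_nonneg hd.le hd.le) hd3]
    _ = (1 - d) * (pairConst C i j * (((1 - d) * tail F u) * ((1 - d) * tail G v))) := by ring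
    _ ≤ (1 - d) * (pairConst C i j * (tail F (u + L) * tail G (v + L))) := by
        gcongr
        · exact tail_nonneg _ _
        · exact h₂ u hu.2.1
        · exact h₃ v hv.2.2
    _ ≤ _ := (h₁ _ _ (by linarith) (by linarith) i j).1

/-- A bound for the joint tails without restriction on the arguments. -/
theorem exists_jointTail_le : ∃ R₀, ∀ R, R₀ ≤ R → ∃ K, 0 < K ∧ ∀ u v i j,
    jointTail μ (X i) (Y j) u v ≤ K * (tail F (max u R) * tail G (max v R)) := by
  have := h.isProbabilityMeasure_fst
  have := h.isProbabilityMeasure_snd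
  have hC := h.const_pos
  obtain ⟨R₀, hR₀⟩ := h.exists_jointTail_near one_pos
  refine ⟨R₀, fun R hR => ?_⟩
  have hF := h.classDL_fst.1 R
  have hG := h.classDL_snd.1 R
  have hF1 : tail F R ≤ 1 := measureReal_le_one
  have hG1 : tail G R ≤ 1 := measureReal_le_one
  -- The denominator lets the trivial bounds `1`, `F̄(u)`, `Ḡ(v)` suffice when an argument lies
  -- below `R`; the asymptotic estimate is needed only when both lie above.
  refine ⟨(2 * (C + 1)) / (tail F R * tail G R), by positivity, fun u v i j => ?_⟩
  rw [div_mul_eq_mul_div, le_div_iff₀ (by positivity)]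
  have hX : jointTail μ (X i) (Y j) u v ≤ tail F u := by
    rw [← real_setOf_lt_eq_tail (h.measurable_fst i) (h.map_fst i)]
    exact measureReal_mono fun _ h => h.1
  have hY : jointTail μ (X i) (Y j) u v ≤ tail G v := by
    rw [← real_setOf_lt_eq_tail (h.measurable_snd j) (h.map_snd j)]
    exact measureReal_mono fun _ h => h.2
  have h1 : jointTail μ (X i) (Y j) u v ≤ 1 := measureReal_le_one
  have h0 := jointTail_nonneg μ (X i) (Y j) u v
  have hFu := tail_nonneg F u
  have hGv := tail_nonneg G v
  rcases le_total u R with hu | hu <;> rcases le_total v R with hv | hv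
  · rw [max_eq_right hu, max_eq_right hv]
    gcongr
    linarith
  · rw [max_eq_right hu, max_eq_left hv]
    calc _ ≤ tail G v * (tail F R * 1) := by gcongr
      _ = 1 * (tail F R * tail G v) := by ring
      _ ≤ _ := by gcongr; linarith
  · rw [max_eq_left hu, max_eq_right hv]
    calc _ ≤ tail F u * (1 * tail G R) := by gcongr
      _ = 1 * (tail F u * tail G R) := by ring
      _ ≤ _ := by gcongr; linarith
  · rw [max_eq_left hu, max_eq_left hv]
    calc _ ≤ jointTail μ (X i) (Y j) u v * (1 * 1) := by gcongr
      _ = jointTail μ (X i) (Y j) u v := by ring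
      _ ≤ (1 + 1) * (pairConst C i j * (tail F u * tail G v)) :=
          (hR₀ u v (by linarith) (by linarith) i j).2
      _ ≤ (1 + 1) * ((C + 1) * (tail F u * tail G v)) := by gcongr; exact pairConst_le hC i j
      _ = _ := by ring

end ClaimPairs

/-- Pigeonhole: `n` terms that are each at most `x / n` cannot add up to more than `x`. -/
theorem exists_div_lt_of_lt_sum {n : ℕ} {w z : ℕ → ℝ} {x : ℝ} (hx : 0 ≤ x)
    (hw : ∀ i < n, 0 ≤ w i ∧ w i ≤ 1)
    (h : x < ∑ i ∈ Finset.range n, max (z i) 0 * w i) : ∃ i < n, x / n < z i := by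
  by_contra! hc
  refine h.not_ge ?_
  have hn : ∀ i ∈ Finset.range n, max (z i) 0 * w i ≤ x / n := fun i hi => by
    have hi := Finset.mem_range.1 hi
    calc _ ≤ max (z i) 0 * 1 := by gcongr; exact (hw i hi).2
      _ ≤ x / n := by rw [mul_one]; exact max_le (hc i hi) (by positivity)
  refine (Finset.sum_le_card_nsmul _ _ _ hn).trans ?_
  rw [Finset.card_range, nsmul_eq_mul]
  rcases n.eq_zero_or_pos with rfl | h0
  · simpa using hx
  · rw [mul_div_cancel₀]; positivity

namespace ClaimPairs

variable {μ : Measure Ω} [IsProbabilityMeasure μ] {X Y : ℕ → Ω → ℝ} {F G : Measure ℝ} {C : ℝ}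
  (h : ClaimPairs μ X Y F G C)
include h

/-- A polynomial bound, in the number of summands, for the joint tail of two weighted sums. -/
theorem exists_real_sum_le : ∃ (K : ℝ) (p : ℕ), 0 < K ∧
    ∀ (n : ℕ) (w : ℕ → ℝ) (x y : ℝ), 0 ≤ x → 0 ≤ y → (∀ i < n, 0 ≤ w i ∧ w i ≤ 1) →
    μ.real {ω | x < ∑ i ∈ Finset.range n, max (X i ω) 0 * w i ∧
      y < ∑ i ∈ Finset.range n, max (Y i ω) 0 * w i} ≤
      K * (n : ℝ) ^ p * (tail F x * tail G y) := by
  have := h.isProbabilityMeasure_fst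
  have := h.isProbabilityMeasure_snd
  obtain ⟨R₁, h₁⟩ := h.classDL_fst.exists_tail_div_le
  obtain ⟨R₂, h₂⟩ := h.classDL_snd.exists_tail_div_le
  obtain ⟨R₃, h₃⟩ := h.exists_jointTail_le
  -- The cutoff must be the same in all three estimates, which is why each of them allows any cutoff
  -- beyond a threshold.
  obtain ⟨p₁, h₁⟩ := h₁ (max R₁ (max R₂ R₃)) (le_max_left _ _)
  obtain ⟨p₂, h₂⟩ := h₂ (max R₁ (max R₂ R₃)) ((le_max_left _ _).trans (le_max_right _ _))
  obtain ⟨K, hK, h₃⟩ := h₃ (max R₁ (max R₂ R₃)) ((le_max_right _ _).trans (le_max_right _ _))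
  set R := max R₁ (max R₂ R₃)
  -- The exponent counts `n ^ 2` pairs of indices, each with a factor `(2n) ^ p₁ * (2n) ^ p₂`.
  refine ⟨K * 2 ^ (p₁ + p₂), 2 + p₁ + p₂, by positivity, fun n w x y hx hy hw => ?_⟩
  have hsub : {ω | x < ∑ i ∈ Finset.range n, max (X i ω) 0 * w i ∧
      y < ∑ i ∈ Finset.range n, max (Y i ω) 0 * w i} ⊆
      ⋃ i ∈ Finset.range n, ⋃ j ∈ Finset.range n, {ω | x / n < X i ω ∧ y / n < Y j ω} := by
    rintro ω ⟨hX, hY⟩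
    obtain ⟨i, hi, hi'⟩ := exists_div_lt_of_lt_sum hx hw hX
    obtain ⟨j, hj, hj'⟩ := exists_div_lt_of_lt_sum hy hw hY
    simp only [mem_iUnion, Finset.mem_range]
    exact ⟨i, hi, j, hj, hi', hj'⟩
  refine (measureReal_mono hsub (measure_ne_top _ _)).trans <| (measureReal_biUnion_finset_le _ _).trans <|
    (Finset.sum_le_sum fun i _ => measureReal_biUnion_finset_le _ _).trans ?_
  have hterm : ∀ i ∈ Finset.range n, ∀ j ∈ Finset.range n,
      μ.real {ω | x / n < X i ω ∧ y / n < Y j ω} ≤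
      K * (((2 * n : ℝ) ^ p₁ * tail F x) * ((2 * n : ℝ) ^ p₂ * tail G y)) := by
    intro i hi j _
    have hn : 1 ≤ n := by have := Finset.mem_range.1 hi; lia
    refine (h₃ (x / n) (y / n) i j).trans ?_
    gcongr
    · exact tail_nonneg _ _
    · exact mul_nonneg (by positivity) (tail_nonneg _ _)
    · exact h₁ n x hn hx
    · exact h₂ n y hn hy
  refine (Finset.sum_le_sum fun i hi => Finset.sum_le_sum fun j hj => hterm i hi j hj).trans
    (le_of_eq ?_)
  simp only [Finset.sum_const, Finset.card_range, nsmul_eq_mul, mul_pow]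
  ring

end ClaimPairs
end Claims

/-! ### One big jump in each line: weighted sums with a fixed number of terms. -/

section Sums

variable {Ω : Type*} [MeasurableSpace Ω]

/-- Either one weighted summand exceeds the level up to a bounded shift, or two summands
are large. -/
theorem exists_lt_or_of_lt_sum {n : ℕ} {w z : ℕ → ℝ} {x a L : ℝ} (hx : 0 ≤ x) (ha : 0 < a)
    (hL : 0 < L) (hw : ∀ i < n, a ≤ w i ∧ w i ≤ 1)
    (h : x < ∑ i ∈ Finset.range n, max (z i) 0 * w i) :
    (∃ i < n, x / w i - L / a < z i) ∨
      ∃ i < n, ∃ k < n, i ≠ k ∧ L / n < |z i| ∧ x / n < z k := by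
  obtain ⟨k, hk, hk'⟩ := exists_div_lt_of_lt_sum hx
    (fun i hi => ⟨ha.le.trans (hw i hi).1, (hw i hi).2⟩) h
  by_contra! hc
  obtain ⟨h1, h2⟩ := hc
  have hn : (0 : ℝ) < n := by exact_mod_cast (Nat.zero_le k).trans_lt hk
  have hwk : 0 < w k := ha.trans_le (hw k hk).1
  have hzk : 0 < z k := lt_of_le_of_lt (by positivity) hk'
  -- Suppose both alternatives fail. The large summand `k` then falls short of `x` by `L`, while the
  -- others, each at most `L / n`, contribute at most `L`.
  have hfirst : max (z k) 0 * w k ≤ x - L := by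
    rw [max_eq_left hzk.le]
    calc z k * w k ≤ (x / w k - L / a) * w k := by gcongr; exact h1 k hk
      _ = x - L * (w k / a) := by field_simp
      _ ≤ x - L := by
        have : 1 ≤ w k / a := (one_le_div ha).2 (hw k hk).1
        nlinarith
  have hrest : ∑ i ∈ (Finset.range n).erase k, max (z i) 0 * w i ≤ L := by
    have hle : ∀ i ∈ (Finset.range n).erase k, max (z i) 0 * w i ≤ L / n := fun i hi => by
      rw [Finset.mem_erase, Finset.mem_range] at hi
      have hz : |z i| ≤ L / n := by
        by_contra! hlt
        exact (h2 i hi.2 k hk hi.1 hlt).not_gt hk'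
      calc _ ≤ max (z i) 0 * 1 := by gcongr; exact (hw i hi.2).2
        _ ≤ L / n := by
          rw [mul_one]; exact max_le ((le_abs_self _).trans hz) (by positivity)
    refine (Finset.sum_le_card_nsmul _ _ _ hle).trans ?_
    have : (((Finset.range n).erase k).card : ℝ) ≤ n := by
      exact_mod_cast (Finset.card_erase_le).trans_eq (Finset.card_range n)
    rw [nsmul_eq_mul]
    calc _ ≤ (n : ℝ) * (L / n) := by gcongr
      _ = L := by field_simp
  rw [← Finset.add_sum_erase _ _ (Finset.mem_range.2 hk)] at h
  linarith

/-- One large summand makes the weighted sum large when the others are bounded. -/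
theorem lt_sum_of_abs_le {n : ℕ} {w z : ℕ → ℝ} {x a L M : ℝ} (ha : 0 < a) (hL : 0 < L)
    (hM : 0 ≤ M) (hw : ∀ i < n, a ≤ w i ∧ w i ≤ 1) {i : ℕ} (hi : i < n)
    (h : x / w i + (M + L) / a < z i) (hm : ∀ m < n, m ≠ i → |z m| ≤ L / n) :
    x + M < ∑ i ∈ Finset.range n, z i * w i := by
  have hn : (0 : ℝ) < n := by exact_mod_cast (Nat.zero_le i).trans_lt hi
  have hwi : 0 < w i := ha.trans_le (hw i hi).1
  have hfirst : x + (M + L) < z i * w i := by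
    calc x + (M + L) ≤ x + (M + L) * (w i / a) := by
          have : 1 ≤ w i / a := (one_le_div ha).2 (hw i hi).1
          nlinarith
      _ = (x / w i + (M + L) / a) * w i := by field_simp
      _ < z i * w i := by gcongr
  have hrest : -L ≤ ∑ i ∈ (Finset.range n).erase i, z i * w i := by
    have hle : ∀ m ∈ (Finset.range n).erase i, -(L / n) ≤ z m * w m := fun m hm' => by
      rw [Finset.mem_erase, Finset.mem_range] at hm'
      have hz := hm m hm'.2 hm'.1
      have hw' := hw m hm'.2
      have : |z m * w m| ≤ L / n := by
        rw [abs_mul, abs_of_pos (ha.trans_le hw'.1)]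
        calc _ ≤ |z m| * 1 := by gcongr; exact hw'.2
          _ ≤ L / n := by rwa [mul_one]
      exact (abs_le.1 this).1
    refine le_trans ?_ (Finset.card_nsmul_le_sum _ _ _ hle)
    have : (((Finset.range n).erase i).card : ℝ) ≤ n := by
      exact_mod_cast (Finset.card_erase_le).trans_eq (Finset.card_range n)
    rw [nsmul_eq_mul, mul_neg, neg_le_neg_iff]
    calc _ ≤ (n : ℝ) * (L / n) := by gcongr
      _ = L := by field_simp
  rw [← Finset.add_sum_erase _ _ (Finset.mem_range.2 hi)]
  linarith

theorem real_le_of_cond_le {μ : Measure Ω} [IsFiniteMeasure μ] {s t : Set Ω} (hs : MeasurableSet s)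
    {ε : ℝ} (hε : 0 ≤ ε) (h : μ[t | s] ≤ ENNReal.ofReal ε) : μ.real (t ∩ s) ≤ ε * μ.real s := by
  have h1 := cond_mul_eq_inter hs t μ
  rw [inter_comm, measureReal_def, ← h1, ENNReal.toReal_mul]
  exact mul_le_mul_of_nonneg_right (ENNReal.toReal_le_of_le_ofReal hε h) measureReal_nonneg

/-- The asymptotic value of the joint tail of two weighted sums. -/
def pairSum (F G : Measure ℝ) (C : ℝ) (n : ℕ) (w : ℕ → ℝ) (x y : ℝ) : ℝ :=
  ∑ i ∈ Finset.range n, ∑ j ∈ Finset.range n,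
    pairConst C i j * (tail F (x / w i) * tail G (y / w j))

theorem pairSum_nonneg {F G : Measure ℝ} {C : ℝ} (hC : 0 < C) (n : ℕ) (w : ℕ → ℝ) (x y : ℝ) :
    0 ≤ pairSum F G C n w x y :=
  Finset.sum_nonneg fun i _ => Finset.sum_nonneg fun j _ =>
    mul_nonneg (pairConst_pos hC i j).le (mul_nonneg (tail_nonneg _ _) (tail_nonneg _ _))

/-- The term with both indices 0 is already this large. The bound does not depend on the weights, so
it can absorb error terms uniformly. -/
theorem le_pairSum {F G : Measure ℝ} [IsFiniteMeasure F] [IsFiniteMeasure G] {C : ℝ} (hC : 0 < C)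
    {n : ℕ} (hn : 0 < n) {w : ℕ → ℝ} {a x y : ℝ} (ha : 0 < a) (hw : a ≤ w 0) (hx : 0 ≤ x)
    (hy : 0 ≤ y) : C * (tail F (x / a) * tail G (y / a)) ≤ pairSum F G C n w x y := by
  have hpos : ∀ i j, 0 ≤ pairConst C i j * (tail F (x / w i) * tail G (y / w j)) := fun i j =>
    mul_nonneg (pairConst_pos hC i j).le (mul_nonneg (tail_nonneg _ _) (tail_nonneg _ _))
  calc C * (tail F (x / a) * tail G (y / a))
      ≤ pairConst C 0 0 * (tail F (x / w 0) * tail G (y / w 0)) := by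
        rw [pairConst, if_pos rfl]
        gcongr
        · exact tail_nonneg _ _
        · exact tail_nonneg _ _
        · exact tail_antitone F (by gcongr)
        · exact tail_antitone G (by gcongr)
    _ ≤ ∑ j ∈ Finset.range n, pairConst C 0 j * (tail F (x / w 0) * tail G (y / w j)) :=
        Finset.single_le_sum (f := fun j => pairConst C 0 j * (tail F (x / w 0) * tail G (y / w j)))
          (fun j _ => hpos 0 j) (Finset.mem_range.2 hn)
    _ ≤ _ := Finset.single_le_sum (f := fun i => ∑ j ∈ Finset.range n,
          pairConst C i j * (tail F (x / w i) * tail G (y / w j)))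
          (fun i _ => Finset.sum_nonneg fun j _ => hpos i j) (Finset.mem_range.2 hn)

theorem pairSum_le {F G : Measure ℝ} [IsFiniteMeasure F] [IsFiniteMeasure G] {C : ℝ} (hC : 0 < C)
    {n : ℕ} {w : ℕ → ℝ} {x y : ℝ} (hw : ∀ i < n, 0 < w i ∧ w i ≤ 1) (hx : 0 ≤ x)
    (hy : 0 ≤ y) : pairSum F G C n w x y ≤ (C + 1) * (n : ℝ) ^ 2 * (tail F x * tail G y) := by
  have hle : ∀ z : ℝ, 0 ≤ z → ∀ i < n, z ≤ z / w i := fun z hz i hi =>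
    le_div_self hz (hw i hi).1 (hw i hi).2
  calc pairSum F G C n w x y
      ≤ ∑ i ∈ Finset.range n, ∑ j ∈ Finset.range n, (C + 1) * (tail F x * tail G y) := by
        refine Finset.sum_le_sum fun i hi => Finset.sum_le_sum fun j hj => ?_
        rw [Finset.mem_range] at hi hj
        have := tail_nonneg F x
        have := tail_nonneg G (y / w j)
        gcongr
        · exact mul_nonneg (tail_nonneg _ _) this
        · exact pairConst_le hC i j
        · exact tail_antitone F (hle x hx i hi)
        · exact tail_antitone G (hle y hy j hj)
    _ = _ := by simp only [Finset.sum_const, Finset.card_range, nsmul_eq_mul]; ring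

namespace ClaimPairs

variable {μ : Measure Ω} [IsProbabilityMeasure μ] {X Y : ℕ → Ω → ℝ} {F G : Measure ℝ} {C : ℝ}
  (h : ClaimPairs μ X Y F G C)
include h

omit [IsProbabilityMeasure μ] in
theorem measurableSet_joint (i j : ℕ) (u v : ℝ) :
    MeasurableSet {ω | u < X i ω ∧ v < Y j ω} :=
  (measurableSet_lt measurable_const (h.measurable_fst i)).inter
    (measurableSet_lt measurable_const (h.measurable_snd j))

/-- GTAI with the conditioning multiplied out; finitely many index triples share one threshold. -/
theorem exists_real_three_le (n : ℕ) {ε : ℝ} (hε : 0 < ε) :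
    ∃ R, ∀ L u v, R ≤ L → R ≤ u → R ≤ v → ∀ i < n, ∀ j < n, ∀ m < n,
      (m ≠ i → μ.real ({ω | L < |X m ω|} ∩ {ω | u < X i ω ∧ v < Y j ω}) ≤
        ε * jointTail μ (X i) (Y j) u v) ∧
      (m ≠ j → μ.real ({ω | L < |Y m ω|} ∩ {ω | u < X i ω ∧ v < Y j ω}) ≤
        ε * jointTail μ (X i) (Y j) u v) := by
  have hε' : (0 : ℝ≥0∞) < ENNReal.ofReal ε := by simpa
  have key : ∀ᶠ p in minAtTop₃, ∀ i ∈ Finset.range n, ∀ j ∈ Finset.range n, ∀ m ∈ Finset.range n,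
      (m ≠ i → μ.real ({ω | p.1 < |X m ω|} ∩ {ω | p.2.1 < X i ω ∧ p.2.2 < Y j ω}) ≤
        ε * jointTail μ (X i) (Y j) p.2.1 p.2.2) ∧
      (m ≠ j → μ.real ({ω | p.1 < |Y m ω|} ∩ {ω | p.2.1 < X i ω ∧ p.2.2 < Y j ω}) ≤
        ε * jointTail μ (X i) (Y j) p.2.1 p.2.2) := by
    simp only [Filter.eventually_all_finset]
    intro i _ j _ m _
    refine Filter.Eventually.and ?_ ?_
    · by_cases hm : m = i
      · exact .of_forall fun _ h => absurd hm h
      filter_upwards [(h.gtai.1 m i j hm).eventually (eventually_le_nhds hε')] with p hp _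
      exact real_le_of_cond_le (h.measurableSet_joint i j _ _) hε.le hp
    · by_cases hm : m = j
      · exact .of_forall fun _ h => absurd hm h
      filter_upwards [(h.gtai.2 m j i hm).eventually (eventually_le_nhds hε')] with p hp _
      exact real_le_of_cond_le (h.measurableSet_joint i j _ _) hε.le hp
  obtain ⟨R, hR⟩ := eventually_minAtTop₃.1 key
  exact ⟨R, fun L u v hL hu hv i hi j hj m hm => hR L u v hL hu hv i (Finset.mem_range.2 hi) j
    (Finset.mem_range.2 hj) m (Finset.mem_range.2 hm)⟩

/-- Dominated variation with factor `a / n`, since `x / n = (a / n) * (x / a)`. Errors at the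
pigeonhole level `x / n` thereby become comparable with the lower bound of `le_pairSum`. -/
theorem exists_jointTail_div_le {n : ℕ} (hn : 0 < n) {a : ℝ} (ha : 0 < a) (ha1 : a ≤ 1) :
    ∃ K, 0 < K ∧ ∃ R, ∀ x y, R ≤ x → R ≤ y → ∀ i j,
      jointTail μ (X i) (Y j) (x / n) (y / n) ≤ K * (tail F (x / a) * tail G (y / a)) := by
  have := h.isProbabilityMeasure_fst
  have := h.isProbabilityMeasure_snd
  have hn' : (1 : ℝ) ≤ n := by exact_mod_cast hn
  have hC := h.const_pos
  have hb : 0 < a / n := by positivity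
  have hb1 : a / n ≤ 1 := by rw [div_le_one (by positivity)]; linarith
  obtain ⟨K₁, hK₁, R₁, h₁⟩ := h.classDL_fst.2.1.exists_tail_mul_le h.classDL_fst.1 hb hb1
  obtain ⟨K₂, hK₂, R₂, h₂⟩ := h.classDL_snd.2.1.exists_tail_mul_le h.classDL_snd.1 hb hb1
  obtain ⟨R₃, h₃⟩ := h.exists_jointTail_near one_pos
  have hdiv : ∀ x : ℝ, a / n * (x / a) = x / n := fun x => by field_simp
  refine ⟨(1 + 1) * ((C + 1) * (K₁ * K₂)), by positivity,
    max 0 (max (max R₁ R₂) (n * R₃)), fun x y hx hy i j => ?_⟩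
  simp only [max_le_iff] at hx hy
  have hle : ∀ x : ℝ, 0 ≤ x → x ≤ x / a := fun x hx => le_div_self hx ha ha1
  have hF := h₁ (x / a) (hx.2.1.1.trans (hle x hx.1))
  have hG := h₂ (y / a) (hy.2.1.2.trans (hle y hy.1))
  rw [hdiv] at hF hG
  have hR₃ : ∀ x : ℝ, n * R₃ ≤ x → R₃ ≤ x / n := fun x hx => by
    rw [le_div_iff₀ (by positivity)]; linarith
  calc jointTail μ (X i) (Y j) (x / n) (y / n)
      ≤ (1 + 1) * (pairConst C i j * (tail F (x / n) * tail G (y / n))) :=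
        (h₃ _ _ (hR₃ x hx.2.2) (hR₃ y hy.2.2) i j).2
    _ ≤ (1 + 1) * ((C + 1) * ((K₁ * tail F (x / a)) * (K₂ * tail G (y / a)))) := by
        have := tail_nonneg F (x / a)
        have := tail_nonneg G (y / n)
        have := tail_nonneg F (x / n)
        have := pairConst_le hC i j
        gcongr
    _ = _ := by ring

/-- Upper asymptotic bound for two weighted sums, uniform in the weights. -/
theorem exists_real_sum_le_pairSum (n : ℕ) {a ε : ℝ} (ha : 0 < a) (ha1 : a ≤ 1) (hε : 0 < ε) :
    ∃ R, ∀ x y, R ≤ x → R ≤ y → ∀ w : ℕ → ℝ, (∀ i < n, a ≤ w i ∧ w i ≤ 1) →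
    μ.real {ω | x < ∑ i ∈ Finset.range n, max (X i ω) 0 * w i ∧
      y < ∑ i ∈ Finset.range n, max (Y i ω) 0 * w i} ≤ (1 + ε) * pairSum F G C n w x y := by
  have := h.isProbabilityMeasure_fst
  have := h.isProbabilityMeasure_snd
  rcases n.eq_zero_or_pos with rfl | hn
  · refine ⟨0, fun x y hx hy w _ => ?_⟩
    have : {ω : Ω | x < ∑ i ∈ Finset.range 0, max (X i ω) 0 * w i ∧
        y < ∑ i ∈ Finset.range 0, max (Y i ω) 0 * w i} = ∅ := by
      ext ω; simp [hx.not_gt]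
    rw [this, measureReal_empty]
    simp [pairSum]
  have hC := h.const_pos
  have hn' : (0 : ℝ) < n := by exact_mod_cast hn
  obtain ⟨K, hK, R₁, h₁⟩ := h.exists_jointTail_div_le hn ha ha1
  -- Each of two families has at most `n ^ 3` error events, of probability at most `δ * K * F̄(x/a)
  -- * Ḡ(y/a)`; this `δ` makes a family cost at most `ε / 4` of `pairSum`.
  set δ := ε * C / (4 * n ^ 3 * K) with hδ
  have hδ0 : 0 < δ := by positivity
  obtain ⟨R₂, h₂⟩ := h.exists_real_three_le n hδ0
  -- Ensures `L / n ≥ R₂`, so that GTAI applies to a second claim above `L / n`.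
  set L := max 1 (n * R₂) with hL
  have hL0 : 0 < L := one_pos.trans_le (le_max_left _ _)
  obtain ⟨R₃, h₃⟩ := h.exists_jointTail_sub_le (half_pos hε) (div_pos hL0 ha)
  refine ⟨max 0 (max R₁ (max (n * R₂) R₃)), fun x y hx hy w hw => ?_⟩
  simp only [max_le_iff] at hx hy
  obtain ⟨hx0, hx1, hx2, hx3⟩ := hx
  obtain ⟨hy0, hy1, hy2, hy3⟩ := hy
  have hR₂ : ∀ x : ℝ, n * R₂ ≤ x → R₂ ≤ x / n := fun x hx => by
    rw [le_div_iff₀ hn']; linarith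
  set S₂ := Finset.range n ×ˢ Finset.range n
  set S₃ := Finset.range n ×ˢ S₂
  have hS₂ : ∀ p ∈ S₂, p.1 < n ∧ p.2 < n := by simp [S₂]
  have hS₃ : ∀ p ∈ S₃, p.1 < n ∧ p.2.1 < n ∧ p.2.2 < n := by simp [S₃, S₂]
  let A : ℕ × ℕ → Set Ω := fun p =>
    {ω | x / w p.1 - L / a < X p.1 ω ∧ y / w p.2 - L / a < Y p.2 ω}
  let B₁ : ℕ × ℕ × ℕ → Set Ω := fun p =>
    {ω | L / n < |X p.1 ω|} ∩ {ω | x / n < X p.2.1 ω ∧ y / n < Y p.2.2 ω}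
  let B₂ : ℕ × ℕ × ℕ → Set Ω := fun p =>
    {ω | L / n < |Y p.1 ω|} ∩ {ω | x / n < X p.2.1 ω ∧ y / n < Y p.2.2 ω}
  have hsub : {ω | x < ∑ i ∈ Finset.range n, max (X i ω) 0 * w i ∧
      y < ∑ i ∈ Finset.range n, max (Y i ω) 0 * w i} ⊆
      (⋃ p ∈ S₂, A p) ∪ ((⋃ p ∈ S₃.filter (fun p => p.1 ≠ p.2.1), B₁ p) ∪
        ⋃ p ∈ S₃.filter (fun p => p.1 ≠ p.2.2), B₂ p) := by
    rintro ω ⟨hX, hY⟩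
    have hw' : ∀ i < n, 0 ≤ w i ∧ w i ≤ 1 := fun i hi => ⟨ha.le.trans (hw i hi).1, (hw i hi).2⟩
    simp only [mem_union, mem_iUnion]
    rcases exists_lt_or_of_lt_sum hx0 ha hL0 hw hX with ⟨i, hi, hi'⟩ | ⟨m, hm, i, hi, hne, hm', hi'⟩
    · rcases exists_lt_or_of_lt_sum hy0 ha hL0 hw hY with
        ⟨j, hj, hj'⟩ | ⟨m, hm, j, hj, hne, hm', hj'⟩
      · exact Or.inl ⟨(i, j), by simp [S₂, hi, hj], hi', hj'⟩
      -- With two large claims in one line, pigeonhole supplies the large claim in the other line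
      -- that GTAI conditions on.
      · obtain ⟨k, hk, hk'⟩ := exists_div_lt_of_lt_sum hx0 hw' hX
        exact Or.inr (Or.inr ⟨(m, k, j), by simp [S₃, S₂, hm, hk, hj, hne], hm', hk', hj'⟩)
    · obtain ⟨k, hk, hk'⟩ := exists_div_lt_of_lt_sum hy0 hw' hY
      exact Or.inr (Or.inl ⟨(m, i, k), by simp [S₃, S₂, hm, hk, hi, hne], hm', hi', hk'⟩)
  set E := tail F (x / a) * tail G (y / a) with hE
  have hE0 : 0 ≤ E := mul_nonneg (tail_nonneg _ _) (tail_nonneg _ _)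
  have hA : μ.real (⋃ p ∈ S₂, A p) ≤ (1 + ε / 2) * pairSum F G C n w x y := by
    refine (measureReal_biUnion_finset_le _ _).trans ?_
    rw [pairSum, ← Finset.sum_product', Finset.mul_sum]
    refine Finset.sum_le_sum fun p hp => ?_
    have hwd : ∀ z : ℝ, 0 ≤ z → ∀ i < n, z ≤ z / w i := fun z hz i hi =>
      le_div_self hz (ha.trans_le (hw i hi).1) (hw i hi).2
    exact h₃ _ _ (hx3.trans (hwd x hx0 _ (hS₂ p hp).1)) (hy3.trans (hwd y hy0 _ (hS₂ p hp).2)) _ _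
  have hcard : ∀ q : ℕ × ℕ × ℕ → Prop, [DecidablePred q] →
      ((S₃.filter q).card : ℝ) ≤ (n : ℝ) ^ 3 := fun q _ => by
    have : (S₃.filter q).card ≤ n ^ 3 := (Finset.card_filter_le _ _).trans_eq (by
      simp only [S₃, S₂, Finset.card_product, Finset.card_range]; ring)
    exact_mod_cast this
  have hB : ∀ (q : ℕ × ℕ × ℕ → Prop) [DecidablePred q] (B : ℕ × ℕ × ℕ → Set Ω),
      (∀ p ∈ S₃.filter q, μ.real (B p) ≤ δ * jointTail μ (X p.2.1) (Y p.2.2) (x / n) (y / n)) →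
      μ.real (⋃ p ∈ S₃.filter q, B p) ≤ ε / 4 * (C * E) := fun q _ B hq => by
    refine (measureReal_biUnion_finset_le _ _).trans ?_
    refine (Finset.sum_le_card_nsmul _ _ (δ * (K * E)) fun p hp => (hq p hp).trans ?_).trans ?_
    · gcongr
      exact h₁ x y hx1 hy1 _ _
    · rw [nsmul_eq_mul]
      calc _ ≤ (n : ℝ) ^ 3 * (δ * (K * E)) := by gcongr; exact hcard q
        _ = ε / 4 * (C * E) := by rw [hδ]; field_simp
  have hLn : R₂ ≤ L / n := hR₂ L (le_max_right _ _)
  have hB₁ := hB (fun p => p.1 ≠ p.2.1) B₁ fun p hp => by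
    rw [Finset.mem_filter] at hp
    obtain ⟨hp1, hp2, hp3⟩ := hS₃ p hp.1
    exact (h₂ _ _ _ hLn (hR₂ x hx2) (hR₂ y hy2) _ hp2 _ hp3 _ hp1).1 hp.2
  have hB₂ := hB (fun p => p.1 ≠ p.2.2) B₂ fun p hp => by
    rw [Finset.mem_filter] at hp
    obtain ⟨hp1, hp2, hp3⟩ := hS₃ p hp.1
    exact (h₂ _ _ _ hLn (hR₂ x hx2) (hR₂ y hy2) _ hp2 _ hp3 _ hp1).2 hp.2
  have hEle : C * E ≤ pairSum F G C n w x y := le_pairSum hC hn ha (hw 0 hn).1 hx0 hy0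
  have h4 := (measureReal_mono hsub (measure_ne_top μ _)).trans
    ((measureReal_union_le _ _).trans (add_le_add_right (measureReal_union_le _ _) _))
  nlinarith

/-- Lower asymptotic bound for two weighted sums, uniform in the weights. -/
theorem exists_pairSum_le_real_sum (n : ℕ) {a ε M : ℝ} (ha : 0 < a) (hε : 0 < ε)
    (hε1 : ε ≤ 1) (hM : 0 ≤ M) :
    ∃ R, ∀ x y, R ≤ x → R ≤ y → ∀ w : ℕ → ℝ, (∀ i < n, a ≤ w i ∧ w i ≤ 1) →
    (1 - ε) * pairSum F G C n w x y ≤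
      μ.real {ω | x + M < ∑ i ∈ Finset.range n, X i ω * w i ∧
        y + M < ∑ i ∈ Finset.range n, Y i ω * w i} := by
  rcases n.eq_zero_or_pos with rfl | hn
  · exact ⟨0, fun x y hx hy w _ => by simp [pairSum]⟩
  have hC := h.const_pos
  have hn' : (1 : ℝ) ≤ n := by exact_mod_cast hn
  have hn0 : (0 : ℝ) < n := by linarith
  -- At most `n` bad events in each line then cost `ε / 4` of the probability of `A p`.
  set δ := ε / (4 * n) with hδ
  have hδ0 : 0 < δ := by positivity
  obtain ⟨R₂, h₂⟩ := h.exists_real_three_le n hδ0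
  set L := max 1 (n * R₂) with hL
  have hL0 : 0 < L := one_pos.trans_le (le_max_left _ _)
  have hLn : R₂ ≤ L / n := by rw [le_div_iff₀ hn0, mul_comm]; exact le_max_right _ _
  have hs : 0 < (M + L) / a := by positivity
  obtain ⟨R₃, h₃⟩ := h.exists_le_jointTail_add (half_pos hε) hs
  refine ⟨max L (max R₂ R₃), fun x y hx hy w hw => ?_⟩
  simp only [max_le_iff] at hx hy
  obtain ⟨hx1, hx2, hx3⟩ := hx
  obtain ⟨hy1, hy2, hy3⟩ := hy
  have hx0 := hL0.le.trans hx1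
  have hy0 := hL0.le.trans hy1
  have hwd : ∀ z : ℝ, 0 ≤ z → ∀ i < n, z ≤ z / w i := fun z hz i hi =>
      le_div_self hz (ha.trans_le (hw i hi).1) (hw i hi).2
  set S₂ := Finset.range n ×ˢ Finset.range n
  have hS₂ : ∀ p ∈ S₂, p.1 < n ∧ p.2 < n := by simp [S₂]
  let A : ℕ × ℕ → Set Ω := fun p =>
    {ω | x / w p.1 + (M + L) / a < X p.1 ω ∧ y / w p.2 + (M + L) / a < Y p.2 ω}
  -- Keeping all other claims small serves twice: they cannot cancel the large ones, and the events
  -- for different `p` become disjoint, so their probabilities add up.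
  let U : ℕ × ℕ → Set Ω := fun p => A p ∩ ({ω | ∀ m < n, m ≠ p.1 → |X m ω| ≤ L / n} ∩
    {ω | ∀ m < n, m ≠ p.2 → |Y m ω| ≤ L / n})
  have hmeas : ∀ (Z : ℕ → Ω → ℝ), (∀ i, Measurable (Z i)) → ∀ k : ℕ,
      MeasurableSet {ω | ∀ m < n, m ≠ k → |Z m ω| ≤ L / n} := fun Z hZ k => by
    simp only [ofPred_forall]
    exact MeasurableSet.iInter fun m => MeasurableSet.iInter fun _ => MeasurableSet.iInter fun _ =>
      measurableSet_le (hZ m).abs measurable_const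
  have hUm : ∀ p, MeasurableSet (U p) := fun p => (h.measurableSet_joint _ _ _ _).inter
    ((hmeas X h.measurable_fst p.1).inter (hmeas Y h.measurable_snd p.2))
  have hsub : (⋃ p ∈ S₂, U p) ⊆ {ω | x + M < ∑ i ∈ Finset.range n, X i ω * w i ∧
      y + M < ∑ i ∈ Finset.range n, Y i ω * w i} := by
    intro ω hω
    simp only [mem_iUnion] at hω
    obtain ⟨p, hp, ⟨hX, hY⟩, hX', hY'⟩ := hω
    exact ⟨lt_sum_of_abs_le ha hL0 hM hw (hS₂ p hp).1 hX hX',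
      lt_sum_of_abs_le ha hL0 hM hw (hS₂ p hp).2 hY hY'⟩
  have hbig : ∀ z : ℝ, L ≤ z → ∀ i < n, L / n < z / w i + (M + L) / a := fun z hz i hi => by
    have := hwd z (hL0.le.trans hz) i hi
    have := div_le_self hL0.le hn'
    linarith
  have hdisj : (S₂ : Set (ℕ × ℕ)).PairwiseDisjoint U := by
    intro p hp q hq hpq
    refine Set.disjoint_left.2 ?_
    rintro ω ⟨⟨hX, hY⟩, hX', hY'⟩ ⟨⟨hX2, hY2⟩, hX2', hY2'⟩
    have hp := hS₂ p hp
    have hq := hS₂ q hq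
    by_cases h1 : p.1 = q.1
    · have h2 : p.2 ≠ q.2 := fun h2 => hpq (Prod.ext h1 h2)
      exact ((hbig y hy1 _ hp.2).trans (hY.trans_le ((le_abs_self _).trans
        (hY2' _ hp.2 h2)))).false
    · exact ((hbig x hx1 _ hp.1).trans (hX.trans_le ((le_abs_self _).trans
        (hX2' _ hp.1 h1)))).false
  have hU : ∀ p ∈ S₂, (1 - ε / 2) * μ.real (A p) ≤ μ.real (U p) := fun p hp => by
    obtain ⟨hp1, hp2⟩ := hS₂ p hp
    have hAsub : A p ⊆ U p ∪ ((⋃ m ∈ (Finset.range n).erase p.1, {ω | L / n < |X m ω|} ∩ A p) ∪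
        ⋃ m ∈ (Finset.range n).erase p.2, {ω | L / n < |Y m ω|} ∩ A p) := by
      intro ω hω
      by_contra hc
      simp only [mem_union, mem_iUnion, Finset.mem_erase, Finset.mem_range, not_or, not_exists] at hc
      refine hc.1 ⟨hω, fun m hm hm' => ?_, fun m hm hm' => ?_⟩
      · by_contra! hlt
        exact hc.2.1 m ⟨hm', hm⟩ ⟨hlt, hω⟩
      · by_contra! hlt
        exact hc.2.2 m ⟨hm', hm⟩ ⟨hlt, hω⟩
    have hbad : ∀ (k : ℕ) (B : ℕ → Set Ω), (∀ m ∈ (Finset.range n).erase k,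
        μ.real (B m) ≤ δ * μ.real (A p)) →
        μ.real (⋃ m ∈ (Finset.range n).erase k, B m) ≤ ε / 4 * μ.real (A p) := fun k B hB => by
      refine (measureReal_biUnion_finset_le _ _).trans
        ((Finset.sum_le_card_nsmul _ _ _ hB).trans ?_)
      have : (((Finset.range n).erase k).card : ℝ) ≤ n := by
        exact_mod_cast (Finset.card_erase_le).trans_eq (Finset.card_range n)
      rw [nsmul_eq_mul]
      calc _ ≤ (n : ℝ) * (δ * μ.real (A p)) := by gcongr
        _ = ε / 4 * μ.real (A p) := by rw [hδ]; field_simp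
    have hu : R₂ ≤ x / w p.1 + (M + L) / a := by linarith [hwd x hx0 _ hp1]
    have hv : R₂ ≤ y / w p.2 + (M + L) / a := by linarith [hwd y hy0 _ hp2]
    have hb₁ := hbad p.1 (fun m => {ω | L / n < |X m ω|} ∩ A p) fun m hm => by
      rw [Finset.mem_erase, Finset.mem_range] at hm
      exact (h₂ _ _ _ hLn hu hv _ hp1 _ hp2 m hm.2).1 hm.1
    have hb₂ := hbad p.2 (fun m => {ω | L / n < |Y m ω|} ∩ A p) fun m hm => by
      rw [Finset.mem_erase, Finset.mem_range] at hm
      exact (h₂ _ _ _ hLn hu hv _ hp1 _ hp2 m hm.2).2 hm.1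
    have h4 := (measureReal_mono hAsub (measure_ne_top μ _)).trans
      ((measureReal_union_le _ _).trans (add_le_add_right (measureReal_union_le _ _) _))
    linarith
  refine le_trans ?_ (measureReal_mono hsub (measure_ne_top _ _))
  rw [measureReal_biUnion_finset hdisj fun p _ => hUm p, pairSum, ← Finset.sum_product',
    Finset.mul_sum]
  refine Finset.sum_le_sum fun p hp => le_trans ?_ (hU p hp)
  obtain ⟨hp1, hp2⟩ := hS₂ p hp
  have h5 := h₃ _ _ (hx3.trans (hwd x hx0 _ hp1)) (hy3.trans (hwd y hy0 _ hp2)) p.1 p.2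
  set q := pairConst C p.1 p.2 * (tail F (x / w p.1) * tail G (y / w p.2)) with hq
  have hq0 : 0 ≤ q := mul_nonneg (pairConst_pos hC _ _).le
    (mul_nonneg (tail_nonneg _ _) (tail_nonneg _ _))
  calc (1 - ε) * q ≤ (1 - ε / 2) * ((1 - ε / 2) * q) := by nlinarith [mul_nonneg (sq_nonneg ε) hq0]
    _ ≤ _ := mul_le_mul_of_nonneg_left h5 (by linarith)

end ClaimPairs
end Sums

/-! ### Renewal arrivals, moments of the counting process, independence. -/

section Arrivals

variable {Ω : Type*} [MeasurableSpace Ω]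

theorem measurable_arrival {θ : ℕ → Ω → ℝ} (hθ : ∀ i, Measurable (θ i)) (i : ℕ) :
    Measurable (arrival θ i) :=
  Finset.measurable_fun_sum _ fun k _ => hθ k

theorem measurable_counting {θ : ℕ → Ω → ℝ} (hθ : ∀ i, Measurable (θ i)) (t : ℝ) :
    Measurable (counting θ t) := by
  refine measurable_ncard.comp (measurable_set_iff.2 fun i => ?_)
  exact measurableSet_setOfPred.1 (measurableSet_le (measurable_arrival hθ i) measurable_const)

/-- The assumptions on the inter-arrival times. -/
structure InterArrivals (μ : Measure Ω) (θ : ℕ → Ω → ℝ) : Prop where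
  measurable : ∀ i, Measurable (θ i)
  iIndepFun : iIndepFun θ μ
  identDistrib : ∀ i, IdentDistrib (θ i) (θ 0) μ μ
  pos : ∀ i, ∀ᵐ ω ∂μ, 0 < θ i ω

namespace InterArrivals

variable {μ : Measure Ω} [IsProbabilityMeasure μ] {θ : ℕ → Ω → ℝ} (h : InterArrivals μ θ)
include h

theorem integrable_exp_neg : Integrable (fun ω => Real.exp (-θ 0 ω)) μ := by
  refine Integrable.of_bound (h.measurable 0).neg.exp.aestronglyMeasurable 1 ?_
  filter_upwards [h.pos 0] with ω hω
  rw [Real.norm_eq_abs, abs_of_pos (Real.exp_pos _), Real.exp_le_one_iff]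
  linarith

/-- Strict because `1 - e^{-θ}` is positive almost surely. This value is the geometric rate at which
`P(T_n ≤ t)` decays. -/
theorem mgf_lt_one : mgf (θ 0) μ (-1) < 1 := by
  have h1 : 0 < ∫ ω, (1 - Real.exp (-θ 0 ω)) ∂μ := by
    rw [integral_pos_iff_support_of_nonneg_ae]
    · have : Function.support (fun ω => 1 - Real.exp (-θ 0 ω)) =ᵐ[μ] univ := by
        refine eventuallyEq_univ.2 ?_
        filter_upwards [h.pos 0] with ω hω
        have : Real.exp (-θ 0 ω) < 1 := Real.exp_lt_one_iff.2 (by linarith)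
        exact (sub_pos.2 this).ne'
      rw [measure_congr this, measure_univ]
      exact one_pos
    · filter_upwards [h.pos 0] with ω hω
      exact sub_nonneg.2 (Real.exp_le_one_iff.2 (by linarith))
    · exact (integrable_const 1).sub h.integrable_exp_neg
  rw [integral_sub (integrable_const 1) h.integrable_exp_neg] at h1
  simp only [integral_const, probReal_univ, smul_eq_mul, mul_one] at h1
  simp only [mgf, neg_mul, one_mul]
  linarith

/-- Chernoff's bound with parameter `-1`; the exponent is `n + 1` because arrivals are numbered from
zero. -/
theorem real_arrival_le (n : ℕ) (t : ℝ) :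
    μ.real {ω | arrival θ n ω ≤ t} ≤ Real.exp t * mgf (θ 0) μ (-1) ^ (n + 1) := by
  have hint : Integrable (fun ω => Real.exp (-1 * arrival θ n ω)) μ := by
    refine Integrable.of_bound
      ((measurable_arrival h.measurable n).const_mul (-1)).exp.aestronglyMeasurable 1 ?_
    filter_upwards [ae_all_iff.2 h.pos] with ω hω
    rw [Real.norm_eq_abs, abs_of_pos (Real.exp_pos _), Real.exp_le_one_iff]
    have : 0 ≤ arrival θ n ω := Finset.sum_nonneg fun k _ => (hω k).le
    linarith
  refine (measure_le_le_exp_mul_mgf t (by norm_num : (-1 : ℝ) ≤ 0) hint).trans (le_of_eq ?_)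
  have : arrival θ n = ∑ k ∈ Finset.range (n + 1), θ k := by ext ω; simp [arrival]
  rw [this, h.iIndepFun.mgf_sum h.measurable]
  rw [Finset.prod_congr rfl fun k _ => mgf_congr_of_identDistrib (θ k) (θ 0) (h.identDistrib k) (-1)]
  simp

theorem exists_real_arrival_le (t : ℝ) : ∃ q, 0 ≤ q ∧ q < 1 ∧
    ∀ n, μ.real {ω | arrival θ n ω ≤ t} ≤ Real.exp t * q ^ (n + 1) :=
  ⟨_, mgf_nonneg, h.mgf_lt_one, fun n => h.real_arrival_le n t⟩

/-- Geometric decay beats any power. The weight is `(n + 1) ^ p` since `N(t) = n + 1` forces `T_n ≤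
t` in the zero-based numbering. -/
theorem tsum_pow_mul_measure_lt_top (p : ℕ) (t : ℝ) :
    ∑' n : ℕ, ENNReal.ofReal (((n + 1 : ℕ) : ℝ) ^ p) * μ {ω | arrival θ n ω ≤ t} < ∞ := by
  obtain ⟨q, hq0, hq1, hq⟩ := h.exists_real_arrival_le t
  have hs : Summable fun n : ℕ => ((n + 1 : ℕ) : ℝ) ^ p * (Real.exp t * q ^ (n + 1)) := by
    have hq' : ‖q‖ < 1 := by rwa [Real.norm_eq_abs, abs_of_nonneg hq0]
    have h1 : Summable fun n : ℕ => Real.exp t * ((n : ℝ) ^ p * q ^ n) :=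
      (summable_pow_mul_geometric_of_norm_lt_one p hq').mul_left _
    have h2 := (summable_nat_add_iff 1).2 h1
    refine h2.congr fun n => ?_
    exact mul_left_comm _ _ _
  refine lt_of_le_of_lt (ENNReal.tsum_le_tsum fun n => ?_) hs.tsum_ofReal_lt_top
  rw [ENNReal.ofReal_mul (by positivity)]
  gcongr
  exact (ENNReal.le_ofReal_iff_toReal_le (measure_ne_top _ _) (by positivity)).2 (hq n)

theorem renewalMean_lt_top (t : ℝ) : renewalMean μ θ t < ∞ := by
  simpa [renewalMean] using h.tsum_pow_mul_measure_lt_top 0 t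

/-- Almost surely, the counting process and the arrival times are inverse to each other. -/
theorem ae_arrival_le_iff : ∀ᵐ ω ∂μ, (∀ i, 0 < θ i ω) ∧
    ∀ (t : ℝ) (i : ℕ), arrival θ i ω ≤ t ↔ i < counting θ t ω := by
  -- Borel–Cantelli. Finiteness is essential because `Set.ncard` is 0 on infinite sets.
  have hfin : ∀ m : ℕ, ∀ᵐ ω ∂μ, {i | arrival θ i ω ≤ m}.Finite := fun m =>
    ae_finite_setOfPred_mem (s := fun i => {ω | arrival θ i ω ≤ m}) (h.renewalMean_lt_top m).ne
  filter_upwards [ae_all_iff.2 h.pos, ae_all_iff.2 hfin] with ω hpos hfin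
  refine ⟨hpos, fun t i => ?_⟩
  have hmono : StrictMono fun i => arrival θ i ω := strictMono_nat_of_lt_succ fun i => by
    simp only [arrival]
    rw [Finset.sum_range_succ _ (i + 1)]
    linarith [hpos (i + 1)]
  obtain ⟨m, hm⟩ := exists_nat_ge t
  have hft : {i | arrival θ i ω ≤ t}.Finite := (hfin m).subset fun i hi => le_trans hi hm
  have hlow : ∀ i ∈ {i | arrival θ i ω ≤ t}, ∀ j ≤ i, j ∈ {i | arrival θ i ω ≤ t} :=
    fun i hi j hj => (hmono.monotone hj).trans hi
  constructor
  · intro hi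
    have h1 : (Finset.range (i + 1) : Set ℕ) ⊆ {i | arrival θ i ω ≤ t} := fun j hj =>
      hlow i hi j (by simpa [Nat.lt_succ_iff] using hj)
    have h2 := Set.ncard_le_ncard h1 hft
    rw [Set.ncard_coe_finset, Finset.card_range] at h2
    exact h2
  · intro hi
    by_contra hc
    have h1 : {i | arrival θ i ω ≤ t} ⊆ (Finset.range i : Set ℕ) := fun j hj => by
      simp only [Finset.coe_range, mem_Iio]
      by_contra! hij
      exact hc (hlow j hj i hij)
    have h2 := Set.ncard_le_ncard h1 (Finset.finite_toSet _)
    rw [Set.ncard_coe_finset, Finset.card_range] at h2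
    exact absurd hi (not_lt.2 h2)

theorem integrable_counting_pow (p : ℕ) (t : ℝ) :
    Integrable (fun ω => (counting θ t ω : ℝ) ^ p) μ := by
  have hm : Measurable fun ω => (counting θ t ω : ℝ) ^ p :=
    (measurable_from_top.comp (measurable_counting h.measurable t) :
      Measurable fun ω => (counting θ t ω : ℝ)).pow_const p
  refine ⟨hm.aestronglyMeasurable, ?_⟩
  rw [hasFiniteIntegral_iff_ofReal (ae_of_all _ fun ω => by positivity)]
  -- If `N = n + 1`, term `n` alone equals `N ^ p`; the summand 1 covers `N = 0`, where `0 ^ 0 = 1`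
  -- may occur.
  have hbound : ∀ᵐ ω ∂μ, ENNReal.ofReal ((counting θ t ω : ℝ) ^ p) ≤
      1 + ∑' n : ℕ, ENNReal.ofReal (((n + 1 : ℕ) : ℝ) ^ p) *
        {ω | arrival θ n ω ≤ t}.indicator 1 ω := by
    filter_upwards [h.ae_arrival_le_iff] with ω hω
    rcases hN : counting θ t ω with _ | n
    · refine le_add_right ?_
      rw [ENNReal.ofReal_le_one]
      exact pow_le_one₀ (by simp) (by simp)
    · refine le_add_left ((le_of_eq ?_).trans (ENNReal.le_tsum n))
      rw [indicator_of_mem]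
      · simp
      · exact (hω.2 t n).2 (by lia)
  refine (lintegral_mono_ae hbound).trans_lt ?_
  rw [lintegral_add_left measurable_const, lintegral_tsum]
  · simp only [lintegral_const, measure_univ, mul_one]
    refine ENNReal.add_lt_top.2 ⟨ENNReal.one_lt_top, ?_⟩
    refine lt_of_le_of_lt (le_of_eq (tsum_congr fun n => ?_)) (h.tsum_pow_mul_measure_lt_top p t)
    have hs := measurableSet_le (measurable_arrival h.measurable n) (measurable_const (a := t))
    rw [lintegral_const_mul _ (measurable_one.indicator hs), lintegral_indicator_one hs]
  · intro n
    have hs := measurableSet_le (measurable_arrival h.measurable n) (measurable_const (a := t))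
    exact ((measurable_one.indicator hs).const_mul _).aemeasurable

end InterArrivals

omit [MeasurableSpace Ω] in
theorem arrival_pos {θ : ℕ → Ω → ℝ} {ω : Ω} (hω : ∀ i, 0 < θ i ω) (i : ℕ) : 0 < arrival θ i ω :=
  Finset.sum_pos (fun k _ => hω k) ⟨0, by simp⟩

/-- The arrival times recovered from the counting process. -/
def arrivalOfCounting (n : ℝ≥0 → ℕ) (i : ℕ) : ℝ :=
  (⨅ q : ℚ, if i < n (q : ℝ).toNNReal then (((q : ℝ).toNNReal : ℝ) : EReal) else ⊤).toReal

theorem measurable_arrivalOfCounting : Measurable arrivalOfCounting := by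
  refine measurable_pi_lambda _ fun i => measurable_ereal_toReal.comp (Measurable.iInf fun q => ?_)
  exact Measurable.ite (measurableSet_lt measurable_const (measurable_pi_apply _))
    measurable_const measurable_const

/-- `T_i` is the first time at which `N` exceeds `i`, and by density rational times detect it;
negative rationals are truncated to 0, before every arrival. Independence assumed for `N` thus
passes to the arrival times. -/
theorem InterArrivals.ae_arrivalOfCounting_eq {μ : Measure Ω} [IsProbabilityMeasure μ]
    {θ : ℕ → Ω → ℝ} (h : InterArrivals μ θ) :
    ∀ᵐ ω ∂μ, arrivalOfCounting (fun t : ℝ≥0 => counting θ t ω) = fun i => arrival θ i ω := by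
  filter_upwards [h.ae_arrival_le_iff] with ω hω
  ext i
  have hpos := arrival_pos hω.1 i
  have : (⨅ q : ℚ, if i < counting θ ((q : ℝ).toNNReal : ℝ) ω
      then (((q : ℝ).toNNReal : ℝ) : EReal) else ⊤) = (arrival θ i ω : EReal) := by
    simp only [← hω.2]
    refine le_antisymm ?_ (le_iInf fun q => ?_)
    · refine EReal.le_of_forall_lt_iff_le.1 fun z hz => ?_
      rw [EReal.coe_lt_coe_iff] at hz
      obtain ⟨q, hq1, hq2⟩ := exists_rat_btwn hz
      refine iInf_le_of_le q ?_
      rw [Real.coe_toNNReal _ (hpos.trans hq1).le, if_pos hq1.le]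
      exact_mod_cast hq2.le
    · split_ifs with hq
      · exact_mod_cast hq
      · exact le_top
  rw [arrivalOfCounting, this, EReal.toReal_coe]

section Independence

variable {μ : Measure Ω} [IsProbabilityMeasure μ] {X Y θ : ℕ → Ω → ℝ}
  {C₁ C₂ : Ω → StieltjesFunction ℝ}

theorem MutuallyIndependent.indepFun_claims_arrival (hi : MutuallyIndependent μ X Y C₁ C₂ θ)
    (hθ : InterArrivals μ θ) :
    IndepFun (fun ω (i : ℕ) => (X i ω, Y i ω)) (fun ω i => arrival θ i ω) μ := by
  have h1 : IndepFun (fun ω (i : ℕ) => (X i ω, Y i ω))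
      (fun ω (t : ℝ≥0) => counting θ t ω) μ :=
    iIndep.indep hi (show (0 : Fin 3) ≠ 2 by decide)
  exact (h1.comp measurable_id measurable_arrivalOfCounting).congr (ae_eq_refl _)
    hθ.ae_arrivalOfCounting_eq

theorem MutuallyIndependent.indepFun_prod_premiums (hi : MutuallyIndependent μ X Y C₁ C₂ θ)
    (hX : ∀ i, Measurable (X i)) (hY : ∀ i, Measurable (Y i))
    (hC₁ : ∀ t, Measurable (fun ω => C₁ ω t)) (hC₂ : ∀ t, Measurable (fun ω => C₂ ω t))
    (hθ : InterArrivals μ θ) (t : ℝ≥0) :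
    IndepFun (fun ω => ((fun i : ℕ => (X i ω, Y i ω)), fun i => arrival θ i ω))
      (fun ω => (C₁ ω t, C₂ ω t)) μ := by
  have hZ : Measurable fun ω (i : ℕ) => (X i ω, Y i ω) :=
    measurable_pi_lambda _ fun i => (hX i).prodMk (hY i)
  have hD : Measurable fun ω (t : ℝ≥0) => (C₁ ω t, C₂ ω t) :=
    measurable_pi_lambda _ fun t => (hC₁ t).prodMk (hC₂ t)
  have hN : Measurable fun ω (t : ℝ≥0) => counting θ t ω :=
    measurable_pi_lambda _ fun t => measurable_counting hθ.measurable t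
  have hle : ∀ i : Fin 3, (![
      MeasurableSpace.comap (fun ω (i : ℕ) => (X i ω, Y i ω)) inferInstance,
      MeasurableSpace.comap (fun ω (t : ℝ≥0) => (C₁ ω t, C₂ ω t)) inferInstance,
      MeasurableSpace.comap (fun ω (t : ℝ≥0) => counting θ t ω) inferInstance] :
        Fin 3 → MeasurableSpace Ω) i ≤ ‹MeasurableSpace Ω› := by
    intro i
    fin_cases i
    exacts [hZ.comap_le, hD.comap_le, hN.comap_le]
  -- Claims (0) and counting process (2) are grouped against the premiums (1).
  have h1 := indep_iSup_of_disjoint hle hi (S := {0, 2}) (T := {1}) (by simp)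
  have h2 : IndepFun (fun ω => ((fun i : ℕ => (X i ω, Y i ω)), fun t : ℝ≥0 => counting θ t ω))
      (fun ω (t : ℝ≥0) => (C₁ ω t, C₂ ω t)) μ := by
    rw [IndepFun_iff_Indep]
    refine indep_of_indep_of_le_left (indep_of_indep_of_le_right h1 ?_) ?_
    · simp
    · refine (MeasurableSpace.comap_prodMk _ _).le.trans ?_
      rw [iSup_insert, iSup_singleton]
      rfl
  exact (h2.comp (measurable_id.prodMap measurable_arrivalOfCounting)
    (measurable_pi_apply t)).congr
    (hθ.ae_arrivalOfCounting_eq.mono fun ω hω => Prod.ext rfl hω) (ae_eq_refl _)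

end Independence
end Arrivals

/-! ### The mean of the conditional asymptotic value is `Δ`. -/

section Delta

/-- Summation over pairs, split into the diagonal and the two triangles. -/
theorem tsum_tsum_eq_diag_add (g : ℕ → ℕ → ℝ≥0∞) :
    ∑' i, ∑' j, g i j = ∑' i, g i i + ∑' j, ∑' k, (g j (j + k + 1) + g (j + k + 1) j) := by
  have hrow : ∀ i, ∑' j, g i j =
      (∑' j, if j < i then g i j else 0) + (g i i + ∑' k, g i (i + k + 1)) := fun i => by
    have h1 := Summable.sum_add_tsum_nat_add' (f := g i) (k := i + 1) ENNReal.summable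
    have h2 : (∑' j, if j < i then g i j else 0) = ∑ j ∈ Finset.range i, g i j := by
      rw [tsum_eq_sum (s := Finset.range i) fun j hj => if_neg (by simpa using hj)]
      exact Finset.sum_congr rfl fun j hj => if_pos (Finset.mem_range.1 hj)
    rw [← h1, h2, Finset.sum_range_succ, add_assoc]
    congr 3 with k
    congr 1
    lia
  have hcol : ∀ j, (∑' i, if j < i then g i j else 0) = ∑' k, g (j + k + 1) j := fun j => by
    have h1 := Summable.sum_add_tsum_nat_add' (f := fun i => if j < i then g i j else 0)
      (k := j + 1) ENNReal.summable
    rw [← h1, Finset.sum_eq_zero, zero_add]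
    · refine tsum_congr fun k => ?_
      rw [if_pos (by lia)]
      congr 1
      lia
    · intro i hi
      rw [if_neg (by simpa [Nat.lt_succ_iff] using hi)]
  simp only [hrow, ENNReal.tsum_add]
  rw [ENNReal.tsum_comm]
  simp only [hcol]
  ring

variable {Ω : Type*} [MeasurableSpace Ω] {μ : Measure Ω} [IsProbabilityMeasure μ]

omit [MeasurableSpace Ω] in
-- The renewal process restarts after claim `j`. In the double integral of `Δ`, `t` is the earlier
-- arrival and `s` this gap.
theorem arrival_add (θ : ℕ → Ω → ℝ) (j k : ℕ) (ω : Ω) :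
    arrival θ (j + k + 1) ω = arrival θ j ω + arrival (fun l => θ (j + 1 + l)) k ω := by
  simp only [arrival]
  rw [show j + k + 1 + 1 = (j + 1) + (k + 1) by ring, Finset.sum_range_add]

namespace InterArrivals

variable {θ : ℕ → Ω → ℝ} (h : InterArrivals μ θ)
include h

omit [IsProbabilityMeasure μ] in
theorem identDistrib_arrival_shift (j k : ℕ) :
    IdentDistrib (arrival (fun l => θ (j + 1 + l)) k) (arrival θ k) μ μ := by
  have h1 : ProbabilityTheory.iIndepFun (fun l => θ (j + 1 + l)) μ :=
    h.iIndepFun.precomp (g := fun l => j + 1 + l) fun a b hab => by simpa using hab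
  have h2 := IdentDistrib.pi (fun l => (h.identDistrib (j + 1 + l)).trans (h.identDistrib l).symm)
    h1 h.iIndepFun
  exact h2.comp (u := fun v : ℕ → ℝ => ∑ i ∈ Finset.range (k + 1), v i) (by fun_prop)

omit [IsProbabilityMeasure μ] in
theorem indepFun_arrival_shift (j k : ℕ) :
    IndepFun (arrival (fun l => θ (j + 1 + l)) k) (arrival θ j) μ := by
  have h1 := h.iIndepFun.indepFun_finset (Finset.Ico (j + 1) (j + 1 + (k + 1)))
    (Finset.range (j + 1)) (by
      rw [Finset.disjoint_left]
      intro a ha ha'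
      simp only [Finset.mem_Ico, Finset.mem_range] at ha ha'
      lia) h.measurable
  have h2 := h1.comp (φ := fun v => ∑ i, v i) (ψ := fun v => ∑ i, v i) (by fun_prop) (by fun_prop)
  convert h2 using 1
  · ext ω
    simp only [arrival, Function.comp_apply]
    rw [Finset.sum_coe_sort (Finset.Ico (j + 1) (j + 1 + (k + 1))) fun i => θ i ω,
      Finset.sum_Ico_eq_sum_range]
    simp
  · ext ω
    simp only [arrival, Function.comp_apply]
    rw [Finset.sum_coe_sort (Finset.range (j + 1)) fun i => θ i ω]

omit [IsProbabilityMeasure μ] in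
theorem lintegral_renewalMeasure {f : ℝ → ℝ≥0∞} (hf : Measurable f) :
    ∫⁻ t, f t ∂(renewalMeasure μ θ) = ∑' i, ∫⁻ ω, f (arrival θ i ω) ∂μ := by
  rw [renewalMeasure, lintegral_sum_measure]
  exact tsum_congr fun i => lintegral_map hf (measurable_arrival h.measurable i)

/-- The product of the laws of `T_k` and `T_j` is the joint law of the gap `T_{j+k+1} - T_j` and
`T_j`, which are independent. -/
theorem lintegral_renewalMeasure_prod {f : ℝ × ℝ → ℝ≥0∞} (hf : Measurable f) :
    ∫⁻ p, f p ∂((renewalMeasure μ θ).prod (renewalMeasure μ θ)) =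
      ∑' j, ∑' k, ∫⁻ ω, f (arrival (fun l => θ (j + 1 + l)) k ω, arrival θ j ω) ∂μ := by
  have hm : ∀ j k, Measurable (arrival (fun l => θ (j + 1 + l)) k) := fun j k =>
    measurable_arrival (fun l => h.measurable (j + 1 + l)) k
  have key : ∀ j k, ∫⁻ p, f p ∂((μ.map (arrival θ k)).prod (μ.map (arrival θ j))) =
      ∫⁻ ω, f (arrival (fun l => θ (j + 1 + l)) k ω, arrival θ j ω) ∂μ := fun j k => by
    rw [← (h.identDistrib_arrival_shift j k).map_eq,
      ← (h.indepFun_arrival_shift j k).map_prod_eq_prod_map_map (hm j k).aemeasurable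
        (measurable_arrival h.measurable j).aemeasurable,
      lintegral_map hf ((hm j k).prodMk (measurable_arrival h.measurable j))]
  rw [renewalMeasure, Measure.prod_sum, lintegral_sum_measure, ENNReal.tsum_prod', ENNReal.tsum_comm]
  exact tsum_congr fun j => tsum_congr fun k => key j k

end InterArrivals

/-- The discount factors at the arrival times. -/
def discount (r : ℝ) (s : ℕ → ℝ) (i : ℕ) : ℝ := Real.exp (-(r * s i))

theorem div_discount (r : ℝ) (s : ℕ → ℝ) (i : ℕ) (x : ℝ) :
    x / discount r s i = x * Real.exp (r * s i) := by
  rw [discount, Real.exp_neg, div_inv_eq_mul]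

/-- Given the arrival times, the asymptotic value of the ruin probability. -/
def conditionalDelta (F G : Measure ℝ) (C r T : ℝ) (θ : ℕ → Ω → ℝ) (x y : ℝ) (ω : Ω) : ℝ :=
  pairSum F G C (counting θ T ω) (discount r fun i => arrival θ i ω) x y

variable {F G : Measure ℝ} [IsFiniteMeasure F] [IsFiniteMeasure G] {C r T : ℝ} {θ : ℕ → Ω → ℝ}

theorem measurable_pairSum_discount (hθ : ∀ i, Measurable (θ i)) (n : ℕ) (x y : ℝ) :
    Measurable fun ω : Ω => pairSum F G C n (discount r fun i => arrival θ i ω) x y := by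
  have hd : ∀ i, Measurable fun ω => discount r (fun i => arrival θ i ω) i := fun i =>
    ((measurable_arrival hθ i).const_mul r).neg.exp
  have hf : ∀ i, Measurable fun ω => tail F (x / discount r (fun i => arrival θ i ω) i) := fun i =>
    (measurable_tail F).comp ((hd i).const_div x)
  have hg : ∀ i, Measurable fun ω => tail G (y / discount r (fun i => arrival θ i ω) i) := fun i =>
    (measurable_tail G).comp ((hd i).const_div y)
  simp only [pairSum]
  refine Finset.measurable_fun_sum _ fun i _ => Finset.measurable_fun_sum _ fun j _ => ?_
  exact ((hf i).fun_mul (hg j)).const_mul (pairConst C i j)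

theorem measurable_conditionalDelta (hθ : ∀ i, Measurable (θ i)) (x y : ℝ) :
    Measurable (conditionalDelta F G C r T θ x y) := by
  have h1 : Measurable fun p : ℕ × Ω =>
      pairSum F G C p.1 (discount r fun i => arrival θ i p.2) x y :=
    measurable_from_prod_countable_right fun n => measurable_pairSum_discount hθ n x y
  have h2 := h1.comp ((measurable_counting hθ T).prodMk measurable_id)
  simp only [Function.comp_def] at h2
  exact h2

theorem discount_mem (hr : 0 ≤ r) {s : ℕ → ℝ} {i : ℕ} (h0 : 0 ≤ s i) (hT : s i ≤ T) :
    Real.exp (-(r * T)) ≤ discount r s i ∧ discount r s i ≤ 1 := by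
  constructor
  · exact Real.exp_le_exp.2 (neg_le_neg (mul_le_mul_of_nonneg_left hT hr))
  · exact Real.exp_le_one_iff.2 (neg_nonpos.2 (mul_nonneg hr h0))

namespace InterArrivals

variable (h : InterArrivals μ θ)
include h

theorem ae_conditionalDelta_le (hC : 0 < C) (hr : 0 ≤ r) : ∀ᵐ ω ∂μ, ∀ x y, 0 ≤ x → 0 ≤ y →
    conditionalDelta F G C r T θ x y ω ≤
      (C + 1) * (counting θ T ω : ℝ) ^ 2 * (tail F x * tail G y) := by
  filter_upwards [h.ae_arrival_le_iff] with ω hω x y hx hy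
  exact pairSum_le hC (fun i hi => ⟨Real.exp_pos _, (discount_mem hr (arrival_pos hω.1 i).le
    ((hω.2 T i).2 hi)).2⟩) hx hy

theorem integrable_conditionalDelta (hC : 0 < C) (hr : 0 ≤ r) {x y : ℝ} (hx : 0 ≤ x)
    (hy : 0 ≤ y) : Integrable (conditionalDelta F G C r T θ x y) μ := by
  refine Integrable.mono' (((h.integrable_counting_pow 2 T).const_mul (C + 1)).mul_const
    (tail F x * tail G y)) (measurable_conditionalDelta h.measurable x y).aestronglyMeasurable ?_
  filter_upwards [h.ae_conditionalDelta_le (F := F) (G := G) (T := T) hC hr] with ω hω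
  rw [Real.norm_of_nonneg (show 0 ≤ conditionalDelta F G C r T θ x y ω from
    pairSum_nonneg hC _ _ _ _)]
  exact hω x y hx hy

/-- Working in `[0, ∞]` permits free rearrangement. Splitting the double sum over arrivals up to `T`
into diagonal and triangles yields the two integrals; each pair `j < j + k + 1` contributes both
orders. -/
theorem lintegral_conditionalDelta (hC : 0 < C) (x y : ℝ) :
    ∫⁻ ω, ENNReal.ofReal (conditionalDelta F G C r T θ x y ω) ∂μ =
      ENNReal.ofReal C * (∫⁻ t in Icc 0 T, ENNReal.ofReal
        (tail F (x * Real.exp (r * t)) * tail G (y * Real.exp (r * t))) ∂(renewalMeasure μ θ)) +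
      ∫⁻ p in {p : ℝ × ℝ | 0 ≤ p.1 ∧ 0 ≤ p.2 ∧ p.1 + p.2 ≤ T}, ENNReal.ofReal
        (tail F (x * Real.exp (r * (p.2 + p.1))) * tail G (y * Real.exp (r * p.2)) +
          tail F (x * Real.exp (r * p.2)) * tail G (y * Real.exp (r * (p.2 + p.1))))
        ∂((renewalMeasure μ θ).prod (renewalMeasure μ θ)) := by
  have hF := measurable_tail F
  have hG := measurable_tail G
  let e : ℝ → ℝ → ℝ := fun s t => tail F (x * Real.exp (r * s)) * tail G (y * Real.exp (r * t))
  have he0 : ∀ s t, 0 ≤ e s t := fun s t => mul_nonneg (tail_nonneg _ _) (tail_nonneg _ _)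
  have he : Measurable fun p : ℝ × ℝ => e p.1 p.2 :=
    (hF.comp (by fun_prop)).mul (hG.comp (by fun_prop))
  let A : Set (ℝ × ℝ) := {p : ℝ × ℝ | 0 ≤ p.1 ∧ 0 ≤ p.2 ∧ p.1 + p.2 ≤ T}
  have hA : MeasurableSet A := (measurableSet_le measurable_const measurable_fst).inter
    ((measurableSet_le measurable_const measurable_snd).inter
      (measurableSet_le (measurable_fst.add measurable_snd) measurable_const))
  let d : ℝ → ℝ≥0∞ := fun t => (Icc 0 T).indicator (fun t => ENNReal.ofReal (e t t)) t
  let u : ℝ × ℝ → ℝ≥0∞ := fun p => A.indicator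
    (fun p => ENNReal.ofReal (e (p.2 + p.1) p.2 + e p.2 (p.2 + p.1))) p
  have hd : Measurable d := (he.comp (measurable_id.prodMk measurable_id)).ennreal_ofReal.indicator
    measurableSet_Icc
  have hu : Measurable u := by
    refine Measurable.indicator (Measurable.ennreal_ofReal ?_) hA
    exact (he.comp (f := fun p : ℝ × ℝ => (p.2 + p.1, p.2)) (by fun_prop)).add
      (he.comp (f := fun p : ℝ × ℝ => (p.2, p.2 + p.1)) (by fun_prop))
  have hae : ∀ᵐ ω ∂μ, ENNReal.ofReal (conditionalDelta F G C r T θ x y ω) =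
      ∑' i, ENNReal.ofReal C * d (arrival θ i ω) +
      ∑' j, ∑' k, u (arrival (fun l => θ (j + 1 + l)) k ω, arrival θ j ω) := by
    filter_upwards [h.ae_arrival_le_iff] with ω hω
    let g : ℕ → ℕ → ℝ≥0∞ := fun i j => if arrival θ i ω ≤ T ∧ arrival θ j ω ≤ T then
      ENNReal.ofReal (pairConst C i j * e (arrival θ i ω) (arrival θ j ω)) else 0
    have hsum : ENNReal.ofReal (conditionalDelta F G C r T θ x y ω) = ∑' i, ∑' j, g i j := by
      have hterm : ∀ i j, 0 ≤ pairConst C i j * e (arrival θ i ω) (arrival θ j ω) := fun i j =>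
        mul_nonneg (pairConst_pos hC i j).le (he0 _ _)
      simp only [conditionalDelta, pairSum, div_discount]
      rw [ENNReal.ofReal_sum_of_nonneg fun i _ => Finset.sum_nonneg fun j _ => hterm i j,
        tsum_eq_sum (s := Finset.range (counting θ T ω))]
      · refine Finset.sum_congr rfl fun i hi => ?_
        rw [ENNReal.ofReal_sum_of_nonneg fun j _ => hterm i j,
          tsum_eq_sum (s := Finset.range (counting θ T ω))]
        · refine Finset.sum_congr rfl fun j hj => ?_
          rw [Finset.mem_range, ← hω.2] at hi hj
          exact (if_pos ⟨hi, hj⟩).symm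
        · intro j hj
          rw [Finset.mem_range, ← hω.2] at hj
          exact if_neg fun hc => hj hc.2
      · intro i hi
        rw [Finset.mem_range, ← hω.2] at hi
        exact ENNReal.tsum_eq_zero.2 fun j => if_neg fun hc => hi hc.1
    rw [hsum, tsum_tsum_eq_diag_add]
    congr 1
    · refine tsum_congr fun i => ?_
      simp only [g, d, pairConst, if_true, and_self, indicator, mem_Icc,
        (arrival_pos hω.1 i).le, true_and]
      split_ifs
      · exact ENNReal.ofReal_mul hC.le
      · simp
    · refine tsum_congr fun j => tsum_congr fun k => ?_
      have hj := arrival_pos hω.1 j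
      have hk : 0 < arrival (fun l => θ (j + 1 + l)) k ω :=
        arrival_pos (θ := fun l => θ (j + 1 + l)) (fun i => hω.1 _) k
      have hne : j ≠ j + k + 1 := by lia
      simp only [g, u, A, pairConst, if_neg hne, if_neg hne.symm, arrival_add, indicator,
        mem_ofPred_eq, hj.le, hk.le, true_and, one_mul]
      simp only [add_comm (arrival (fun l => θ (j + 1 + l)) k ω)]
      -- Only the later of the two arrivals has to be compared with `T`.
      by_cases hT : arrival θ j ω + arrival (fun l => θ (j + 1 + l)) k ω ≤ T
      · have hT' : arrival θ j ω ≤ T := by linarith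
        rw [if_pos ⟨hT', hT⟩, if_pos ⟨hT, hT'⟩, if_pos hT, ← ENNReal.ofReal_add (he0 _ _) (he0 _ _),
          add_comm]
      · rw [if_neg fun hc => hT hc.2, if_neg fun hc => hT hc.1, if_neg hT, add_zero]
  have hm : ∀ i, Measurable (arrival θ i) := measurable_arrival h.measurable
  have hm' : ∀ j k, Measurable fun ω => u (arrival (fun l => θ (j + 1 + l)) k ω, arrival θ j ω) :=
    fun j k => hu.comp ((measurable_arrival (fun l => h.measurable _) k).prodMk (hm j))
  have hmd : ∀ i, Measurable fun ω => ENNReal.ofReal C * d (arrival θ i ω) :=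
    fun i => (hd.comp (hm i)).const_mul _
  rw [lintegral_congr_ae hae, lintegral_add_left (Measurable.tsum hmd),
    lintegral_tsum fun i => (hmd i).aemeasurable,
    lintegral_tsum fun j => (Measurable.tsum fun k => hm' j k).aemeasurable]
  congr 1
  · rw [← lintegral_indicator measurableSet_Icc]
    change _ = ENNReal.ofReal C * ∫⁻ t, d t ∂(renewalMeasure μ θ)
    rw [h.lintegral_renewalMeasure hd, ← ENNReal.tsum_mul_left]
    exact tsum_congr fun i => lintegral_const_mul _ (hd.comp (hm i))
  · rw [← lintegral_indicator hA]
    change _ = ∫⁻ p, u p ∂((renewalMeasure μ θ).prod (renewalMeasure μ θ))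
    rw [h.lintegral_renewalMeasure_prod hu]
    exact tsum_congr fun j => lintegral_tsum fun k => (hm' j k).aemeasurable

theorem integral_conditionalDelta (hC : 0 < C) (hr : 0 ≤ r) {x y : ℝ} (hx : 0 ≤ x)
    (hy : 0 ≤ y) : ∫ ω, conditionalDelta F G C r T θ x y ω ∂μ =
      deltaApprox F G (renewalMeasure μ θ) r C T x y := by
  have hF := measurable_tail F
  have hG := measurable_tail G
  have hfin := (h.integrable_conditionalDelta (F := F) (G := G) (T := T) hC hr hx hy)
  have h0 : 0 ≤ᵐ[μ] conditionalDelta F G C r T θ x y := ae_of_all _ fun ω =>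
    pairSum_nonneg hC _ _ _ _
  have hlt := (hasFiniteIntegral_iff_ofReal h0).1 hfin.2
  rw [integral_eq_lintegral_of_nonneg_ae h0 hfin.1]
  rw [h.lintegral_conditionalDelta hC] at hlt ⊢
  obtain ⟨h1, h2⟩ := ENNReal.add_lt_top.1 hlt
  rw [ENNReal.toReal_add h1.ne h2.ne, ENNReal.toReal_mul, ENNReal.toReal_ofReal hC.le, add_comm,
    deltaApprox, integral_eq_lintegral_of_nonneg_ae, integral_eq_lintegral_of_nonneg_ae]
  · exact ae_of_all _ fun t => mul_nonneg (tail_nonneg _ _) (tail_nonneg _ _)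
  · exact ((hF.comp (by fun_prop)).mul (hG.comp (by fun_prop))).aestronglyMeasurable
  · exact ae_of_all _ fun p => add_nonneg (mul_nonneg (tail_nonneg _ _) (tail_nonneg _ _))
      (mul_nonneg (tail_nonneg _ _) (tail_nonneg _ _))
  · exact (((hF.comp (by fun_prop)).mul (hG.comp (by fun_prop))).add
      ((hF.comp (by fun_prop)).mul (hG.comp (by fun_prop)))).aestronglyMeasurable

end InterArrivals
end Delta

/-! ### Weighted sums with a random number of terms. -/

section RandomSums

variable {Ω : Type*} [MeasurableSpace Ω] {μ : Measure Ω} [IsProbabilityMeasure μ]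

/-- Fubini's theorem for an event depending on two independent random elements. -/
theorem integrable_and_real_eq_integral_of_indepFun {α β : Type*} [MeasurableSpace α]
    [MeasurableSpace β] {Z : Ω → α} {W : Ω → β} (hZ : Measurable Z) (hW : Measurable W)
    (hi : IndepFun Z W μ) {S : Set (α × β)} (hS : MeasurableSet S) :
    Integrable (fun ω => μ.real {ω' | (Z ω', W ω) ∈ S}) μ ∧
      μ.real {ω | (Z ω, W ω) ∈ S} = ∫ ω, μ.real {ω' | (Z ω', W ω) ∈ S} ∂μ := by
  have : IsProbabilityMeasure (μ.map Z) := Measure.isProbabilityMeasure_map hZ.aemeasurable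
  have : IsProbabilityMeasure (μ.map W) := Measure.isProbabilityMeasure_map hW.aemeasurable
  have hm : Measurable fun w => (μ.map Z) ((fun z => (z, w)) ⁻¹' S) :=
    measurable_measure_prodMk_right hS
  have heq : ∀ w, (μ.map Z) ((fun z => (z, w)) ⁻¹' S) = μ {ω' | (Z ω', w) ∈ S} := fun w =>
    Measure.map_apply hZ (measurable_prodMk_right hS)
  have hmeas : Measurable fun ω => μ {ω' | (Z ω', W ω) ∈ S} := by
    simp only [heq] at hm
    exact hm.comp hW
  constructor
  · refine Integrable.of_bound hmeas.ennreal_toReal.aestronglyMeasurable 1 (ae_of_all _ fun ω => ?_)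
    rw [Real.norm_of_nonneg measureReal_nonneg]
    exact measureReal_le_one
  · have h1 : μ {ω | (Z ω, W ω) ∈ S} = ∫⁻ ω, μ {ω' | (Z ω', W ω) ∈ S} ∂μ := by
      calc μ {ω | (Z ω, W ω) ∈ S} = (μ.map fun ω => (Z ω, W ω)) S :=
            (Measure.map_apply (hZ.prodMk hW) hS).symm
        _ = ∫⁻ w, (μ.map Z) ((fun z => (z, w)) ⁻¹' S) ∂(μ.map W) := by
            rw [hi.map_prod_eq_prod_map_map hZ.aemeasurable hW.aemeasurable,
              Measure.prod_apply_symm hS]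
        _ = _ := by
            rw [lintegral_map hm hW]
            simp only [heq]
    simp only [measureReal_def]
    rw [integral_toReal hmeas.aemeasurable (ae_of_all _ fun ω => measure_lt_top _ _), h1]

/-- The joint tail of two weighted sums with deterministic weights. -/
def sumTail (μ : Measure Ω) (X Y : ℕ → Ω → ℝ) (n : ℕ) (w : ℕ → ℝ) (x y : ℝ) : ℝ :=
  μ.real {ω | x < ∑ i ∈ Finset.range n, X i ω * w i ∧ y < ∑ i ∈ Finset.range n, Y i ω * w i}

/-- The event that a random sum exceeds `x` and another one exceeds `y`, for given claims and
arrival times. -/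
def exceedance (r T x y : ℝ) : Set ((ℕ → ℝ × ℝ) × (ℕ → ℝ)) :=
  {q | x < ∑ i ∈ Finset.range {i | q.2 i ≤ T}.ncard, (q.1 i).1 * discount r q.2 i ∧
    y < ∑ i ∈ Finset.range {i | q.2 i ≤ T}.ncard, (q.1 i).2 * discount r q.2 i}

theorem measurableSet_exceedance (r T x y : ℝ) : MeasurableSet (exceedance r T x y) := by
  have hN : Measurable fun q : (ℕ → ℝ × ℝ) × (ℕ → ℝ) => {i | q.2 i ≤ T}.ncard := by
    refine measurable_ncard.comp (measurable_set_iff.2 fun i => ?_)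
    exact measurableSet_setOfPred.1 (measurableSet_le
      ((measurable_pi_apply i).comp measurable_snd) measurable_const)
  have hsum : ∀ f : ℝ × ℝ → ℝ, Measurable f →
      Measurable fun q : (ℕ → ℝ × ℝ) × (ℕ → ℝ) =>
        ∑ i ∈ Finset.range {i | q.2 i ≤ T}.ncard, f (q.1 i) * discount r q.2 i := fun f hf => by
    have h1 : Measurable fun p : ℕ × ((ℕ → ℝ × ℝ) × (ℕ → ℝ)) =>
        ∑ i ∈ Finset.range p.1, f (p.2.1 i) * discount r p.2.2 i := by
      refine measurable_from_prod_countable_right fun n => ?_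
      change Measurable fun q : (ℕ → ℝ × ℝ) × (ℕ → ℝ) =>
        ∑ i ∈ Finset.range n, f (q.1 i) * discount r q.2 i
      refine Finset.measurable_fun_sum _ fun i _ => ?_
      unfold discount
      fun_prop
    have h2 := h1.comp (hN.prodMk measurable_id)
    simp only [Function.comp_def] at h2
    exact h2
  exact (measurableSet_lt measurable_const (hsum _ measurable_fst)).inter
    (measurableSet_lt measurable_const (hsum _ measurable_snd))

/-- Independence freezes the arrival times, so that bounds uniform in deterministic weights can be
applied pointwise under the integral. -/
theorem integrable_and_real_exceedance_eq {X Y θ : ℕ → Ω → ℝ} (hX : ∀ i, Measurable (X i))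
    (hY : ∀ i, Measurable (Y i)) (hθ : ∀ i, Measurable (θ i))
    (hi : IndepFun (fun ω (i : ℕ) => (X i ω, Y i ω)) (fun ω i => arrival θ i ω) μ)
    (r T x y : ℝ) :
    Integrable (fun ω => sumTail μ X Y (counting θ T ω) (discount r fun i => arrival θ i ω) x y) μ ∧
    μ.real {ω | ((fun i => (X i ω, Y i ω)), fun i => arrival θ i ω) ∈ exceedance r T x y} =
      ∫ ω, sumTail μ X Y (counting θ T ω) (discount r fun i => arrival θ i ω) x y ∂μ :=
  integrable_and_real_eq_integral_of_indepFun (measurable_pi_lambda _ fun i => (hX i).prodMk (hY i))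
    (measurable_pi_lambda _ fun i => measurable_arrival hθ i) hi (measurableSet_exceedance r T x y)

namespace InterArrivals

variable {F G : Measure ℝ} [IsFiniteMeasure F] [IsFiniteMeasure G] {C r T : ℝ} {θ : ℕ → Ω → ℝ}
  (h : InterArrivals μ θ)
include h

omit [IsProbabilityMeasure μ] in
theorem measurableSet_lt_counting (n : ℕ) (t : ℝ) : MeasurableSet {ω | n < counting θ t ω} :=
  measurableSet_lt measurable_const (measurable_counting h.measurable t)

theorem exists_setIntegral_counting_pow_le (p : ℕ) (t : ℝ) {δ : ℝ} (hδ : 0 < δ) :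
    ∃ n, ∫ ω in {ω | n < counting θ t ω}, (counting θ t ω : ℝ) ^ p ∂μ ≤ δ := by
  have h1 := tendsto_setIntegral_of_antitone (μ := μ)
    (f := fun ω => (counting θ t ω : ℝ) ^ p) (s := fun n : ℕ => {ω | n < counting θ t ω})
    (fun n => h.measurableSet_lt_counting n t)
    (fun m n hmn ω hω => lt_of_le_of_lt hmn hω)
    ⟨0, (h.integrable_counting_pow p t).integrableOn⟩
  have h2 : (⋂ n : ℕ, {ω | n < counting θ t ω}) = ∅ := by
    refine eq_empty_of_forall_notMem fun ω hω => ?_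
    exact lt_irrefl (counting θ t ω) (mem_iInter.1 hω (counting θ t ω))
  rw [h2, setIntegral_empty] at h1
  exact (h1.eventually (eventually_le_nhds hδ)).exists

/-- With positive probability there is a claim by time `T`; its term in `pairSum` is at least `C *
F̄(x/a) * Ḡ(y/a)`, and dominated variation leads back from `x / a` to `x`. Small multiples of
`F̄(x)Ḡ(y)` are therefore negligible against `Δ`. -/
theorem exists_mul_tail_le_integral (hF : ClassDL F) (hG : ClassDL G) (hC : 0 < C) (hr : 0 ≤ r)
    (hT : 0 ≤ T) (hlam : 0 < renewalMean μ θ T) : ∃ c, 0 < c ∧ ∃ R, ∀ x y, R ≤ x → R ≤ y →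
      c * (tail F x * tail G y) ≤ ∫ ω, conditionalDelta F G C r T θ x y ω ∂μ := by
  set a := Real.exp (-(r * T)) with ha
  have ha0 : 0 < a := Real.exp_pos _
  have ha1 : a ≤ 1 := Real.exp_le_one_iff.2 (neg_nonpos.2 (mul_nonneg hr hT))
  obtain ⟨K₁, hK₁, R₁, h₁⟩ := hF.2.1.exists_tail_mul_le hF.1 ha0 ha1
  obtain ⟨K₂, hK₂, R₂, h₂⟩ := hG.2.1.exists_tail_mul_le hG.1 ha0 ha1
  have hP : 0 < μ.real {ω | 0 < counting θ T ω} := by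
    obtain ⟨i, hi⟩ : ∃ i, μ {ω | arrival θ i ω ≤ T} ≠ 0 := by
      by_contra! hc
      exact hlam.ne' (ENNReal.tsum_eq_zero.2 hc)
    refine ENNReal.toReal_pos (fun h0 => hi (measure_mono_null_ae ?_ h0)) (measure_ne_top _ _)
    filter_upwards [h.ae_arrival_le_iff] with ω hω hi'
    exact (Nat.zero_le i).trans_lt ((hω.2 T i).1 hi')
  set P := μ.real {ω | 0 < counting θ T ω}
  refine ⟨C * P / (K₁ * K₂), by positivity, max 0 (max R₁ R₂), fun x y hx hy => ?_⟩
  simp only [max_le_iff] at hx hy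
  have hle : ∀ z : ℝ, 0 ≤ z → z ≤ z / a := fun z hz => le_div_self hz ha0 ha1
  have hFx := h₁ (x / a) (hx.2.1.trans (hle x hx.1))
  have hGy := h₂ (y / a) (hy.2.2.trans (hle y hy.1))
  rw [mul_div_cancel₀ _ ha0.ne'] at hFx hGy
  have hF0 := tail_nonneg F (x / a)
  have hG0 := tail_nonneg G (y / a)
  have hms := h.measurableSet_lt_counting 0 T
  calc C * P / (K₁ * K₂) * (tail F x * tail G y)
      ≤ C * P / (K₁ * K₂) * ((K₁ * tail F (x / a)) * (K₂ * tail G (y / a))) := by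
        have := tail_nonneg F x
        have := tail_nonneg G y
        gcongr
    _ = P * (C * (tail F (x / a) * tail G (y / a))) := by field_simp
    _ = ∫ ω, {ω | 0 < counting θ T ω}.indicator
          (fun _ => C * (tail F (x / a) * tail G (y / a))) ω ∂μ := by
        rw [integral_indicator hms, setIntegral_const, smul_eq_mul]
    _ ≤ _ := by
        refine integral_mono_ae ((integrable_const _).indicator hms)
          (h.integrable_conditionalDelta hC hr hx.1 hy.1) ?_
        filter_upwards [h.ae_arrival_le_iff] with ω hω
        by_cases hN : 0 < counting θ T ω
        · rw [indicator_of_mem (show ω ∈ {ω | 0 < counting θ T ω} from hN)]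
          exact le_pairSum hC hN ha0 (discount_mem hr (arrival_pos hω.1 0).le
            ((hω.2 T 0).2 hN)).1 hx.1 hy.1
        · rw [indicator_of_notMem (show ω ∉ {ω | 0 < counting θ T ω} from hN)]
          exact pairSum_nonneg hC _ _ _ _

end InterArrivals

theorem exists_forall_le_of_lt (f : ℕ → ℝ) (n : ℕ) : ∃ R, ∀ m ≤ n, f m ≤ R := by
  obtain ⟨R, hR⟩ := ((Finset.range (n + 1)).image f).exists_le
  exact ⟨R, fun m hm => hR _ (Finset.mem_image_of_mem f (Finset.mem_range.2 (by lia)))⟩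

section Asymptotics

variable {X Y θ : ℕ → Ω → ℝ} {F G : Measure ℝ} {C r T : ℝ}

/-- For `N(T) ≤ n` the uniform estimate applies, with one threshold for finitely many values; for
`N(T) > n` the polynomial bound is integrated. -/
theorem exists_integral_sumTail_le (h : ClaimPairs μ X Y F G C) (hθ : InterArrivals μ θ)
    (hi : IndepFun (fun ω (i : ℕ) => (X i ω, Y i ω)) (fun ω i => arrival θ i ω) μ)
    (hr : 0 ≤ r) (hT : 0 ≤ T) (hlam : 0 < renewalMean μ θ T) {ε : ℝ} (hε : 0 < ε) :
    ∃ R, ∀ x y, R ≤ x → R ≤ y →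
      ∫ ω, sumTail μ (fun i ω => max (X i ω) 0) (fun i ω => max (Y i ω) 0) (counting θ T ω)
        (discount r fun i => arrival θ i ω) x y ∂μ ≤
      (1 + ε) * ∫ ω, conditionalDelta F G C r T θ x y ω ∂μ := by
  have := h.isProbabilityMeasure_fst
  have := h.isProbabilityMeasure_snd
  have hC := h.const_pos
  obtain ⟨c, hc, R₁, h₁⟩ := hθ.exists_mul_tail_le_integral (r := r) h.classDL_fst h.classDL_snd hC
    hr hT hlam
  obtain ⟨K, p, hK, h₂⟩ := h.exists_real_sum_le
  -- The tolerance turns the part `N(T) > n` into `ε / 2 * c * F̄(x) * Ḡ(y)`, at most `ε / 2` of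
  -- `Δ`.
  obtain ⟨n, hn⟩ := hθ.exists_setIntegral_counting_pow_le p T
    (show 0 < ε / 2 * c / K by positivity)
  have ha1 : Real.exp (-(r * T)) ≤ 1 := Real.exp_le_one_iff.2 (neg_nonpos.2 (mul_nonneg hr hT))
  choose R₂ h₃ using fun n =>
    h.exists_real_sum_le_pairSum n (Real.exp_pos (-(r * T))) ha1 (half_pos hε)
  obtain ⟨R₃, hR₃⟩ := exists_forall_le_of_lt R₂ n
  refine ⟨max 0 (max R₁ R₃), fun x y hx hy => ?_⟩
  simp only [max_le_iff] at hx hy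
  have hfg : 0 ≤ tail F x * tail G y := mul_nonneg (tail_nonneg _ _) (tail_nonneg _ _)
  have hms := hθ.measurableSet_lt_counting n T
  have hQ := hθ.integrable_conditionalDelta (F := F) (G := G) (T := T) hC hr hx.1 hy.1
  have hI : Integrable ({ω | n < counting θ T ω}.indicator fun ω => (counting θ T ω : ℝ) ^ p) μ :=
    (hθ.integrable_counting_pow p T).indicator hms
  have hint := (integrable_and_real_exceedance_eq (X := fun i ω => max (X i ω) 0)
    (Y := fun i ω => max (Y i ω) 0) (fun i => (h.measurable_fst i).max measurable_const)
    (fun i => (h.measurable_snd i).max measurable_const) hθ.measurable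
    (hi.comp (φ := fun (z : ℕ → ℝ × ℝ) i => (max (z i).1 0, max (z i).2 0)) (by fun_prop)
      measurable_id) r T x y).1
  calc _ ≤ ∫ ω, ((1 + ε / 2) * conditionalDelta F G C r T θ x y ω +
        (K * (tail F x * tail G y)) * {ω | n < counting θ T ω}.indicator
          (fun ω => (counting θ T ω : ℝ) ^ p) ω) ∂μ := by
        refine integral_mono_ae hint ((hQ.const_mul _).add (hI.const_mul _)) ?_
        filter_upwards [hθ.ae_arrival_le_iff] with ω hω
        have hw : ∀ i < counting θ T ω, Real.exp (-(r * T)) ≤ discount r (arrival θ · ω) i ∧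
            discount r (arrival θ · ω) i ≤ 1 := fun i hi =>
          discount_mem hr (arrival_pos hω.1 i).le ((hω.2 T i).2 hi)
        by_cases hN : n < counting θ T ω
        · rw [indicator_of_mem (show ω ∈ {ω | n < counting θ T ω} from hN)]
          have h5 := h₂ (counting θ T ω) (discount r (arrival θ · ω)) x y hx.1 hy.1
            fun i hi => ⟨(Real.exp_pos _).le, (hw i hi).2⟩
          have h6 : 0 ≤ conditionalDelta F G C r T θ x y ω := pairSum_nonneg hC _ _ _ _
          refine h5.trans ?_
          have : 0 ≤ (1 + ε / 2) * conditionalDelta F G C r T θ x y ω := by positivity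
          linarith
        · rw [indicator_of_notMem (show ω ∉ {ω | n < counting θ T ω} from hN), mul_zero, add_zero]
          have hR := hR₃ _ (not_lt.1 hN)
          exact h₃ _ x y (hR.trans hx.2.2) (hR.trans hy.2.2) _ hw
    _ = (1 + ε / 2) * ∫ ω, conditionalDelta F G C r T θ x y ω ∂μ +
        (K * (tail F x * tail G y)) * ∫ ω in {ω | n < counting θ T ω},
          (counting θ T ω : ℝ) ^ p ∂μ := by
        rw [integral_add (hQ.const_mul _) (hI.const_mul _), integral_const_mul, integral_const_mul,
          integral_indicator hms]
    _ ≤ (1 + ε / 2) * ∫ ω, conditionalDelta F G C r T θ x y ω ∂μ +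
        (K * (tail F x * tail G y)) * (ε / 2 * c / K) := by gcongr
    _ = (1 + ε / 2) * ∫ ω, conditionalDelta F G C r T θ x y ω ∂μ +
        ε / 2 * (c * (tail F x * tail G y)) := by field_simp
    _ ≤ (1 + ε / 2) * ∫ ω, conditionalDelta F G C r T θ x y ω ∂μ +
        ε / 2 * ∫ ω, conditionalDelta F G C r T θ x y ω ∂μ := by
        gcongr
        exact h₁ x y hx.2.1 hy.2.1
    _ = _ := by ring

theorem exists_le_integral_sumTail (h : ClaimPairs μ X Y F G C) (hθ : InterArrivals μ θ)
    (hi : IndepFun (fun ω (i : ℕ) => (X i ω, Y i ω)) (fun ω i => arrival θ i ω) μ)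
    (hr : 0 ≤ r) (hT : 0 ≤ T) (hlam : 0 < renewalMean μ θ T) {ε M : ℝ} (hε : 0 < ε) (hε1 : ε ≤ 1)
    (hM : 0 ≤ M) : ∃ R, ∀ x y, R ≤ x → R ≤ y →
      (1 - ε) * ∫ ω, conditionalDelta F G C r T θ x y ω ∂μ ≤
      ∫ ω, sumTail μ X Y (counting θ T ω) (discount r fun i => arrival θ i ω)
        (x + M) (y + M) ∂μ := by
  have := h.isProbabilityMeasure_fst
  have := h.isProbabilityMeasure_snd
  have hC := h.const_pos
  obtain ⟨c, hc, R₁, h₁⟩ := hθ.exists_mul_tail_le_integral (r := r) h.classDL_fst h.classDL_snd hC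
    hr hT hlam
  obtain ⟨n, hn⟩ := hθ.exists_setIntegral_counting_pow_le 2 T
    (show 0 < ε / 2 * c / (C + 1) by positivity)
  choose R₂ h₃ using fun n =>
    h.exists_pairSum_le_real_sum n (Real.exp_pos (-(r * T))) (half_pos hε) (by linarith) hM
  obtain ⟨R₃, hR₃⟩ := exists_forall_le_of_lt R₂ n
  refine ⟨max 0 (max R₁ R₃), fun x y hx hy => ?_⟩
  simp only [max_le_iff] at hx hy
  have hfg : 0 ≤ tail F x * tail G y := mul_nonneg (tail_nonneg _ _) (tail_nonneg _ _)
  have hms := hθ.measurableSet_lt_counting n T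
  have hQ := hθ.integrable_conditionalDelta (F := F) (G := G) (T := T) hC hr hx.1 hy.1
  have hI : Integrable ({ω | n < counting θ T ω}.indicator fun ω => (counting θ T ω : ℝ) ^ 2) μ :=
    (hθ.integrable_counting_pow 2 T).indicator hms
  have hint := (integrable_and_real_exceedance_eq h.measurable_fst h.measurable_snd hθ.measurable
    hi r T (x + M) (y + M)).1
  calc (1 - ε) * ∫ ω, conditionalDelta F G C r T θ x y ω ∂μ
      = (1 - ε / 2) * ∫ ω, conditionalDelta F G C r T θ x y ω ∂μ -
        ε / 2 * ∫ ω, conditionalDelta F G C r T θ x y ω ∂μ := by ring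
    _ ≤ (1 - ε / 2) * ∫ ω, conditionalDelta F G C r T θ x y ω ∂μ -
        ε / 2 * (c * (tail F x * tail G y)) := by
        gcongr
        exact h₁ x y hx.2.1 hy.2.1
    _ = (1 - ε / 2) * ∫ ω, conditionalDelta F G C r T θ x y ω ∂μ -
        ((C + 1) * (tail F x * tail G y)) * (ε / 2 * c / (C + 1)) := by field_simp
    _ ≤ (1 - ε / 2) * ∫ ω, conditionalDelta F G C r T θ x y ω ∂μ -
        ((C + 1) * (tail F x * tail G y)) * ∫ ω in {ω | n < counting θ T ω},
          (counting θ T ω : ℝ) ^ 2 ∂μ := by gcongr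
    _ = ∫ ω, ((1 - ε / 2) * conditionalDelta F G C r T θ x y ω -
        ((C + 1) * (tail F x * tail G y)) * {ω | n < counting θ T ω}.indicator
          (fun ω => (counting θ T ω : ℝ) ^ 2) ω) ∂μ := by
        rw [integral_sub (hQ.const_mul _) (hI.const_mul _), integral_const_mul, integral_const_mul,
          integral_indicator hms]
    _ ≤ _ := by
        refine integral_mono_ae ((hQ.const_mul _).sub (hI.const_mul _)) hint ?_
        filter_upwards [hθ.ae_arrival_le_iff,
          hθ.ae_conditionalDelta_le (F := F) (G := G) (T := T) hC hr] with ω hω hle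
        by_cases hN : n < counting θ T ω
        · rw [indicator_of_mem (show ω ∈ {ω | n < counting θ T ω} from hN)]
          have h5 := hle x y hx.1 hy.1
          have h6 : 0 ≤ conditionalDelta F G C r T θ x y ω := pairSum_nonneg hC _ _ _ _
          -- For `N(T) > n` the left side is not positive, since the subtracted quadratic bound
          -- dominates `conditionalDelta`.
          refine le_trans ?_ (measureReal_nonneg (μ := μ))
          nlinarith
        · rw [indicator_of_notMem (show ω ∉ {ω | n < counting θ T ω} from hN), mul_zero, sub_zero]
          have hR := hR₃ _ (not_lt.1 hN)
          exact h₃ _ x y (hR.trans hx.2.2) (hR.trans hy.2.2) _ fun i hi =>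
            discount_mem hr (arrival_pos hω.1 i).le ((hω.2 T i).2 hi)

end Asymptotics
end RandomSums

/-! ### From ruin events to weighted sums. -/

section Ruin

variable {Ω : Type*}

theorem discountedPremiums_nonneg (r : ℝ) (C : Ω → StieltjesFunction ℝ) (t : ℝ) (ω : Ω) :
    0 ≤ discountedPremiums r C t ω :=
  integral_nonneg fun _ => (Real.exp_pos _).le

theorem discountedPremiums_le {r : ℝ} (hr : 0 ≤ r) {C : Ω → StieltjesFunction ℝ} {ω : Ω}
    (hC : ∀ t ≤ 0, C ω t = 0) {t : ℝ} (ht : 0 ≤ t) : discountedPremiums r C t ω ≤ C ω t := by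
  have h1 : (C ω).measure.real (Icc 0 t) ≤ C ω t := by
    -- The closed interval has mass `C(t) - C(0-)`, so `C(0-)` must be bounded below.
    have h2 : 0 ≤ Function.leftLim (C ω) 0 := by
      have := (C ω).mono.le_leftLim (show (-1 : ℝ) < 0 by norm_num)
      rwa [hC (-1) (by norm_num)] at this
    have h3 : 0 ≤ C ω t := (hC 0 le_rfl).symm.le.trans ((C ω).mono ht)
    rw [measureReal_def, StieltjesFunction.measure_Icc]
    exact ENNReal.toReal_le_of_le_ofReal h3 (ENNReal.ofReal_le_ofReal (by linarith))
  calc discountedPremiums r C t ω ≤ ∫ _ in Icc 0 t, (1 : ℝ) ∂(C ω).measure := by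
        refine setIntegral_mono_on ?_ ?_ measurableSet_Icc fun s hs => ?_
        · exact (Continuous.continuousOn (by fun_prop)).integrableOn_Icc
        · exact continuousOn_const.integrableOn_Icc
        · exact Real.exp_le_one_iff.2 (neg_nonpos.2 (mul_nonneg hr hs.1))
    _ = (C ω).measure.real (Icc 0 t) := by simp
    _ ≤ C ω t := h1

theorem ruinTimeMax_le_of_lt {r T x y : ℝ} (hr : 0 ≤ r) (hT : 0 < T)
    {C₁ C₂ : Ω → StieltjesFunction ℝ} {X Y θ : ℕ → Ω → ℝ} {ω : Ω}
    (hC₁ : ∀ t ≤ 0, C₁ ω t = 0) (hC₂ : ∀ t ≤ 0, C₂ ω t = 0)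
    (hx : x + C₁ ω T < discountedClaims r X θ T ω) (hy : y + C₂ ω T < discountedClaims r Y θ T ω) :
    ruinTimeMax (surplus r C₁ X θ x) (surplus r C₂ Y θ y) ω ≤ (T : EReal) := by
  refine iInf₂_le T ⟨hT, max_lt ?_ ?_⟩
  · have := discountedPremiums_le hr hC₁ hT.le
    unfold surplus
    linarith
  · have := discountedPremiums_le hr hC₂ hT.le
    unfold surplus
    linarith

theorem ruinTimeAnd_le_ruinTimeMax (U₁ U₂ : ℝ → Ω → ℝ) (ω : Ω) :
    ruinTimeAnd U₁ U₂ ω ≤ ruinTimeMax U₁ U₂ ω := by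
  refine le_iInf₂ fun t ht => iInf₂_le t ⟨ht.1, ?_, ?_⟩
  · refine lt_of_le_of_lt (iInf₂_le t ⟨ht.1.le, le_rfl⟩) ?_
    exact_mod_cast (le_max_left _ _).trans_lt ht.2
  · refine lt_of_le_of_lt (iInf₂_le t ⟨ht.1.le, le_rfl⟩) ?_
    exact_mod_cast (le_max_right _ _).trans_lt ht.2

/-- Passing to positive parts makes the sum monotone in the number of claims, so the moment at which
the surplus is negative no longer matters. -/
theorem lt_sum_of_iInf_surplus_neg {r t x : ℝ} {C : Ω → StieltjesFunction ℝ} {X θ : ℕ → Ω → ℝ}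
    {ω : Ω} {n : ℕ} (hn : ∀ s ≤ t, counting θ s ω ≤ n)
    (h : (⨅ s ∈ Icc 0 t, (surplus r C X θ x s ω : EReal)) < 0) :
    x < ∑ i ∈ Finset.range n, max (X i ω) 0 * discount r (fun i => arrival θ i ω) i := by
  simp only [iInf_lt_iff] at h
  obtain ⟨s, hs, hneg⟩ := h
  have hneg : surplus r C X θ x s ω < 0 := by exact_mod_cast hneg
  have hp := discountedPremiums_nonneg r C s ω
  unfold surplus at hneg
  calc x < discountedClaims r X θ s ω := by linarith
    _ ≤ ∑ i ∈ Finset.range (counting θ s ω),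
          max (X i ω) 0 * discount r (fun i => arrival θ i ω) i :=
        Finset.sum_le_sum fun i _ => mul_le_mul_of_nonneg_right (le_max_left _ _) (Real.exp_pos _).le
    _ ≤ _ := Finset.sum_le_sum_of_subset_of_nonneg (Finset.range_mono (hn s hs.2)) fun i _ _ =>
        mul_nonneg (le_max_right _ _) (Real.exp_pos _).le

theorem lt_sum_of_ruinTimeAnd_le {r T x y : ℝ} {C₁ C₂ : Ω → StieltjesFunction ℝ}
    {X Y θ : ℕ → Ω → ℝ} {ω : Ω}
    (hω : ∀ (t : ℝ) (i : ℕ), arrival θ i ω ≤ t ↔ i < counting θ t ω)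
    (h : ruinTimeAnd (surplus r C₁ X θ x) (surplus r C₂ Y θ y) ω ≤ (T : EReal)) :
    x < ∑ i ∈ Finset.range (counting θ T ω),
        max (X i ω) 0 * discount r (fun i => arrival θ i ω) i ∧
      y < ∑ i ∈ Finset.range (counting θ T ω),
        max (Y i ω) 0 * discount r (fun i => arrival θ i ω) i := by
  -- The infimum in `ruinTimeAnd` need not be attained, so a witness may lie after `T`. It can be
  -- taken before the first arrival after `T`, where no further claim has been counted.
  have h1 : T < arrival θ (counting θ T ω) ω := by
    by_contra! hc
    exact lt_irrefl _ ((hω _ _).1 hc)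
  have h2 : ruinTimeAnd (surplus r C₁ X θ x) (surplus r C₂ Y θ y) ω <
      (arrival θ (counting θ T ω) ω : EReal) := h.trans_lt (by exact_mod_cast h1)
  unfold ruinTimeAnd at h2
  simp only [iInf_lt_iff (α := EReal) (ι := ℝ), iInf_lt_iff] at h2
  obtain ⟨t, ⟨-, hX, hY⟩, ht⟩ := h2
  have ht : t < arrival θ (counting θ T ω) ω := by exact_mod_cast ht
  have hn : ∀ s ≤ t, counting θ s ω ≤ counting θ T ω := fun s hs => by
    by_contra! hc
    exact absurd ((hω s _).2 hc) (not_le.2 (hs.trans_lt ht))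
  refine ⟨lt_sum_of_iInf_surplus_neg (C := C₁) (r := r) hn ?_,
    lt_sum_of_iInf_surplus_neg (C := C₂) (r := r) hn ?_⟩
  · simpa only [iInf_lt_iff, exists_prop] using hX
  · simpa only [iInf_lt_iff, exists_prop] using hY

variable [MeasurableSpace Ω]

theorem exists_le_real_and_le {μ : Measure Ω} [IsProbabilityMeasure μ] {f g : Ω → ℝ}
    {ε : ℝ} (hε : 0 < ε) :
    ∃ M, 0 ≤ M ∧ 1 - ε ≤ μ.real {ω | f ω ≤ M ∧ g ω ≤ M} := by
  have h1 : Tendsto (fun n : ℕ => μ.real {ω | f ω ≤ n ∧ g ω ≤ n}) atTop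
      (𝓝 (μ.real (⋃ n : ℕ, {ω | f ω ≤ n ∧ g ω ≤ n}))) := by
    refine (ENNReal.tendsto_toReal (measure_ne_top _ _)).comp
      (tendsto_measure_iUnion_atTop fun m n hmn ω hω => ?_)
    have : (m : ℝ) ≤ n := by exact_mod_cast hmn
    exact ⟨hω.1.trans this, hω.2.trans this⟩
  have h2 : (⋃ n : ℕ, {ω | f ω ≤ n ∧ g ω ≤ n}) = univ := by
    refine eq_univ_of_forall fun ω => mem_iUnion.2 ?_
    obtain ⟨n, hn⟩ := exists_nat_ge (max (f ω) (g ω))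
    exact ⟨n, (le_max_left _ _).trans hn, (le_max_right _ _).trans hn⟩
  rw [h2, probReal_univ] at h1
  obtain ⟨n, hn⟩ := (h1.eventually (eventually_ge_nhds (show 1 - ε < 1 by linarith))).exists
  exact ⟨n, n.cast_nonneg, hn⟩

theorem isEquivalent_of_forall_bounds {f g : ℝ × ℝ → ℝ}
    (hg : ∃ R, ∀ x y, R ≤ x → R ≤ y → 0 ≤ g (x, y))
    (h : ∀ ε, 0 < ε → ε ≤ 1 → ∃ R, ∀ x y, R ≤ x → R ≤ y →
      (1 - ε) * g (x, y) ≤ f (x, y) ∧ f (x, y) ≤ (1 + ε) * g (x, y)) :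
    f ~[minAtTop₂] g := by
  refine Asymptotics.isLittleO_iff.2 fun c hc => ?_
  obtain ⟨R₁, h₁⟩ := hg
  obtain ⟨R₂, h₂⟩ := h (min c 1) (by positivity) (min_le_right _ _)
  refine eventually_minAtTop₂.2 ⟨max R₁ R₂, fun x y hx hy => ?_⟩
  simp only [max_le_iff] at hx hy
  have h3 := h₁ x y hx.1 hy.1
  obtain ⟨h4, h5⟩ := h₂ x y hx.2 hy.2
  have h6 : min c 1 * g (x, y) ≤ c * g (x, y) := mul_le_mul_of_nonneg_right (min_le_left _ _) h3
  rw [Pi.sub_apply, Real.norm_of_nonneg h3, Real.norm_eq_abs, abs_le]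
  constructor <;> linarith

end Ruin
end RenewalRisk

end

/-! ### The asymptotics of the ruin probabilities. -/

theorem mainTheorem3 {Ω : Type*} [MeasurableSpace Ω] (μ : Measure Ω) [IsProbabilityMeasure μ]
    -- the claims: identically distributed pairs with marginal distributions F and G
    (X Y : ℕ → Ω → ℝ) (hX : ∀ i, Measurable (X i)) (hY : ∀ i, Measurable (Y i))
    (hXY : ∀ i, IdentDistrib (fun ω => (X i ω, Y i ω)) (fun ω => (X 0 ω, Y 0 ω)) μ μ)
    (F G : Measure ℝ) (hXF : ∀ i, μ.map (X i) = F) (hYG : ∀ i, μ.map (Y i) = G)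
    (hF : RenewalRisk.ClassDL F) (hG : RenewalRisk.ClassDL G)
    -- dependence among the claims
    (hGTAI : RenewalRisk.GTAI μ X Y)
    (C : ℝ) (hSAI : ∀ i, RenewalRisk.SAI μ (X i) (Y i) C)
    (hindep : ∀ i j, i ≠ j → IndepFun (X i) (Y j) μ)
    -- the premium processes: nondecreasing right-continuous paths starting from zero
    (C₁ C₂ : Ω → StieltjesFunction ℝ)
    (hC₁ : ∀ t, Measurable (fun ω => C₁ ω t)) (hC₂ : ∀ t, Measurable (fun ω => C₂ ω t))
    (hC₁0 : ∀ ω, ∀ t ≤ 0, C₁ ω t = 0) (hC₂0 : ∀ ω, ∀ t ≤ 0, C₂ ω t = 0)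
    -- the renewal process: independent identically distributed positive inter-arrival times
    (θ : ℕ → Ω → ℝ) (hθ : ∀ i, Measurable (θ i)) (hθiid : iIndepFun θ μ)
    (hθid : ∀ i, IdentDistrib (θ i) (θ 0) μ μ) (hθpos : ∀ i, ∀ᵐ ω ∂μ, 0 < θ i ω)
    (hmutual : RenewalRisk.MutuallyIndependent μ X Y C₁ C₂ θ)
    (r : ℝ) (hr : 0 ≤ r) (T : ℝ) (hT : 0 < T) (hlam : 0 < RenewalRisk.renewalMean μ θ T) :
    ((fun p : ℝ × ℝ => RenewalRisk.ruinProbMax μ r C₁ C₂ X Y θ T p.1 p.2)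
      ~[RenewalRisk.minAtTop₂]
        (fun p : ℝ × ℝ => RenewalRisk.ruinProbAnd μ r C₁ C₂ X Y θ T p.1 p.2)) ∧
    ((fun p : ℝ × ℝ => RenewalRisk.ruinProbAnd μ r C₁ C₂ X Y θ T p.1 p.2)
      ~[RenewalRisk.minAtTop₂]
        (fun p : ℝ × ℝ => RenewalRisk.deltaApprox F G (RenewalRisk.renewalMeasure μ θ)
          r C T p.1 p.2)) := by

  have hcl : RenewalRisk.ClaimPairs μ X Y F G C :=
    ⟨hX, hY, hXY, hXF, hYG, hF, hG, hGTAI, hSAI, hindep⟩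
  have hθ' : RenewalRisk.InterArrivals μ θ := ⟨hθ, hθiid, hθid, hθpos⟩
  have hC := hcl.const_pos
  have := hcl.isProbabilityMeasure_fst
  have := hcl.isProbabilityMeasure_snd
  have hi := hmutual.indepFun_claims_arrival hθ'
  have hΔ : ∀ x y, 0 ≤ x → 0 ≤ y → ∫ ω, RenewalRisk.conditionalDelta F G C r T θ x y ω ∂μ =
      RenewalRisk.deltaApprox F G (RenewalRisk.renewalMeasure μ θ) r C T x y :=
    fun x y hx hy => hθ'.integral_conditionalDelta hC hr hx hy
  have hΔ0 : ∀ x y, 0 ≤ ∫ ω, RenewalRisk.conditionalDelta F G C r T θ x y ω ∂μ := fun x y =>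
    integral_nonneg fun ω => RenewalRisk.pairSum_nonneg hC _ _ _ _
  have hmaxand : ∀ x y, RenewalRisk.ruinProbMax μ r C₁ C₂ X Y θ T x y ≤
      RenewalRisk.ruinProbAnd μ r C₁ C₂ X Y θ T x y := fun x y =>
    measureReal_mono fun ω hω => (RenewalRisk.ruinTimeAnd_le_ruinTimeMax _ _ ω).trans hω
  have hupper : ∀ ε, 0 < ε → ∃ R, ∀ x y, R ≤ x → R ≤ y →
      RenewalRisk.ruinProbAnd μ r C₁ C₂ X Y θ T x y ≤ (1 + ε) *
        RenewalRisk.deltaApprox F G (RenewalRisk.renewalMeasure μ θ) r C T x y := by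
    intro ε hε
    obtain ⟨R, hR⟩ := RenewalRisk.exists_integral_sumTail_le hcl hθ' hi hr hT.le hlam hε
    refine ⟨max 0 R, fun x y hx hy => ?_⟩
    rw [max_le_iff] at hx hy
    rw [← hΔ x y hx.1 hy.1]
    refine le_trans ?_ (hR x y hx.2 hy.2)
    rw [← (RenewalRisk.integrable_and_real_exceedance_eq (X := fun i ω => max (X i ω) 0)
      (Y := fun i ω => max (Y i ω) 0) (fun i => (hX i).max measurable_const)
      (fun i => (hY i).max measurable_const) hθ
      (hi.comp (φ := fun (z : ℕ → ℝ × ℝ) i => (max (z i).1 0, max (z i).2 0)) (by fun_prop)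
        measurable_id) r T x y).2]
    refine ENNReal.toReal_mono (measure_ne_top _ _) (measure_mono_ae ?_)
    filter_upwards [hθ'.ae_arrival_le_iff] with ω hω hruin
    exact RenewalRisk.lt_sum_of_ruinTimeAnd_le hω.2 hruin
  have hlower : ∀ ε, 0 < ε → ε ≤ 1 → ∃ R, ∀ x y, R ≤ x → R ≤ y →
      (1 - ε) * RenewalRisk.deltaApprox F G (RenewalRisk.renewalMeasure μ θ) r C T x y ≤
        RenewalRisk.ruinProbMax μ r C₁ C₂ X Y θ T x y := by
    intro ε hε hε1
    -- Premiums above `M` cost a factor `1 - ε / 2`, the random sums another one, and `(1 - ε / 2)²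
    -- ≥ 1 - ε`.
    obtain ⟨M, hM0, hM⟩ := RenewalRisk.exists_le_real_and_le (μ := μ) (f := fun ω => C₁ ω T)
      (g := fun ω => C₂ ω T) (half_pos hε)
    obtain ⟨R, hR⟩ := RenewalRisk.exists_le_integral_sumTail hcl hθ' hi hr hT.le hlam
      (half_pos hε) (by linarith) hM0
    refine ⟨max 0 R, fun x y hx hy => ?_⟩
    rw [max_le_iff] at hx hy
    rw [← hΔ x y hx.1 hy.1]
    have h1 := hR x y hx.2 hy.2
    rw [← (RenewalRisk.integrable_and_real_exceedance_eq hX hY hθ hi r T (x + M) (y + M)).2] at h1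
    have h2 := hmutual.indepFun_prod_premiums hX hY hC₁ hC₂ hθ' ⟨T, hT.le⟩
    have h3 := h2.measure_inter_preimage_eq_mul
      (RenewalRisk.exceedance r T (x + M) (y + M)) (Iic M ×ˢ Iic M)
      (RenewalRisk.measurableSet_exceedance _ _ _ _) (measurableSet_Iic.prod measurableSet_Iic)
    have h4 := congrArg ENNReal.toReal h3
    rw [ENNReal.toReal_mul] at h4
    have h5 := hΔ0 x y
    calc (1 - ε) * ∫ ω, RenewalRisk.conditionalDelta F G C r T θ x y ω ∂μ
        ≤ ((1 - ε / 2) * ∫ ω, RenewalRisk.conditionalDelta F G C r T θ x y ω ∂μ) * (1 - ε / 2) := by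
          nlinarith [mul_nonneg (sq_nonneg ε) h5]
      _ ≤ μ.real {ω | ((fun i => (X i ω, Y i ω)), fun i => RenewalRisk.arrival θ i ω) ∈
            RenewalRisk.exceedance r T (x + M) (y + M)} * μ.real {ω | C₁ ω T ≤ M ∧ C₂ ω T ≤ M} :=
          mul_le_mul h1 hM (by linarith) measureReal_nonneg
      _ = _ := h4.symm
      _ ≤ _ := by
          refine measureReal_mono fun ω hω => ?_
          obtain ⟨⟨hx', hy'⟩, hM₁, hM₂⟩ := hω
          have hM₁ : C₁ ω T ≤ M := hM₁
          have hM₂ : C₂ ω T ≤ M := hM₂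
          exact RenewalRisk.ruinTimeMax_le_of_lt hr hT (hC₁0 ω) (hC₂0 ω)
            (lt_of_le_of_lt (by linarith) hx') (lt_of_le_of_lt (by linarith) hy')
  have hg0 : ∃ R : ℝ, ∀ x y, R ≤ x → R ≤ y →
      0 ≤ RenewalRisk.deltaApprox F G (RenewalRisk.renewalMeasure μ θ) r C T x y :=
    ⟨0, fun x y hx hy => hΔ x y hx hy ▸ hΔ0 x y⟩
  have hmax : (fun p : ℝ × ℝ => RenewalRisk.ruinProbMax μ r C₁ C₂ X Y θ T p.1 p.2)
      ~[RenewalRisk.minAtTop₂] (fun p : ℝ × ℝ => RenewalRisk.deltaApprox F G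
        (RenewalRisk.renewalMeasure μ θ) r C T p.1 p.2) := by
    refine RenewalRisk.isEquivalent_of_forall_bounds hg0 fun ε hε hε1 => ?_
    obtain ⟨R₁, h₁⟩ := hupper ε hε
    obtain ⟨R₂, h₂⟩ := hlower ε hε hε1
    exact ⟨max R₁ R₂, fun x y hx hy => ⟨h₂ x y ((le_max_right _ _).trans hx)
      ((le_max_right _ _).trans hy), (hmaxand x y).trans (h₁ x y ((le_max_left _ _).trans hx)
      ((le_max_left _ _).trans hy))⟩⟩
  have hand : (fun p : ℝ × ℝ => RenewalRisk.ruinProbAnd μ r C₁ C₂ X Y θ T p.1 p.2)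
      ~[RenewalRisk.minAtTop₂] (fun p : ℝ × ℝ => RenewalRisk.deltaApprox F G
        (RenewalRisk.renewalMeasure μ θ) r C T p.1 p.2) := by
    refine RenewalRisk.isEquivalent_of_forall_bounds hg0 fun ε hε hε1 => ?_
    obtain ⟨R₁, h₁⟩ := hupper ε hε
    obtain ⟨R₂, h₂⟩ := hlower ε hε hε1
    exact ⟨max R₁ R₂, fun x y hx hy => ⟨(h₂ x y ((le_max_right _ _).trans hx)
      ((le_max_right _ _).trans hy)).trans (hmaxand x y), h₁ x y ((le_max_left _ _).trans hx)
      ((le_max_left _ _).trans hy)⟩⟩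
  exact ⟨hmax.trans hand.symm, hand⟩
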